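/- Fix an integer $d\ge 3$ and a real $\beta\ge 0$, and let $\mathbb T_d$ be the infinite $d$-regular tree. For $h\in\mathbb R$, an \emph{Ising Gibbs measure} on $\mathbb T_d$ with inverse temperature $\beta$ and external field $h$ is a probability measure $\nu$ on $\{-1,1\}^{V(\mathbb T_d)}$ satisfying the Dobrushin--Lanford--Ruelle equations: for every finite $\Lambda\subset V(\mathbb T_d)$, $\nu(A)=\int \gamma_\Lambda(A\mid\xi)\,d\nu(\xi)$ for all measurable $A$, where $\gamma_\Lambda(\cdot\mid\xi)$ is the law on configurations $\sigma$ equal to $\xi$ off $\Lambda$ with $$\gamma_\Lambda(\sigma\mid\xi)\ \propto\ \exp\Big(h\sum_{v\in\Lambda}\sigma_v+\beta\,\#\{\{u,v\}\in E(\mathbb T_d):\{u,v\}\cap\Lambda\ne\emptyset,\ \sigma_u=\sigma_v\}\Big).$$ Say that $\nu$ \emph{arises from a broadcast process} (is a tree-indexed Markov chain) if there are a root $v_0$, a probability distribution $p$ on $\{-1,1\}$, and for every vertex $v\neq v_0$ a $2\times 2$ stochastic matrix $K_v$ (possibly depending on $v$) such that for every finite subtree $\Lambda\ni v_0$ and every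 $\xi\in\{-1,1\}^\Lambda$, $$\nu(\sigma_v=\xi_v\ \forall v\in\Lambda)=p(\xi_{v_0})\prod_{v\in\Lambda\setminus\{v_0\}}K_v(\xi_{\mathrm{pa}(v)},\xi_v),$$ where $\mathrm{pa}(v)$ is the neighbour of $v$ closest to $v_0$. Call $\nu$ \emph{translation-invariant} if $\mathbb E_\nu[\sigma_v]$ does not depend on the vertex $v$. Let $\mathcal M_{d,\beta,h}$ be the set of translation-invariant Ising Gibbs measures on $\mathbb T_d$ with parameters $\beta,h$ that arise from a broadcast process. Then for every $\eta\in(-1,1)$ there are a unique $h_\eta\in\mathbb R$ and a unique $\nu_\eta\in\mathcal M_{d,\beta,h_\eta}$ such that $\mathbb E_{\nu_\eta}[\sigma_v]=\eta$ for every vertex $v$ of $\mathbb T_d$; that is, there is exactly one pair $(h,\nu)$ with $h\in\mathbb R$, $\nu\in\mathcal M_{d,\beta,h}$ and $\mathbb E_\nu[\sigma_v]=\eta$ for every $v$. -/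

import Mathlib

open MeasureTheory
open scoped ENNReal

noncomputable section

namespace TreeIsing

variable {V : Type*} [DecidableEq V]

/-- Spin configurations `σ ∈ {±1}^V`, with the product σ-algebra; the spin space is `ℤˣ = {1, -1}`. -/
abbrev Config (V : Type*) : Type _ := V → ℤˣ

/-- The σ-algebra on the spin space is the discrete one. -/
theorem measurableSet_spins (s : Set ℤˣ) : MeasurableSet s :=
  ⟨Units.val '' s, trivial, Set.preimage_image_eq _ Units.val_injective⟩

/-- The spin of `σ` at `v`, as a real number. -/
def spin (σ : Config V) (v : V) : ℝ := ((σ v : ℤ) : ℝ)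

/-- The configuration equal to `τ` on `Λ` and to `ξ` off `Λ`. -/
def glue (Λ : Finset V) (τ : Λ → ℤˣ) (ξ : Config V) : Config V :=
  fun v => if hv : v ∈ Λ then τ ⟨v, hv⟩ else ξ v

/-- The finite set of edges of `G` that have at least one endpoint in `Λ`. -/
def touchingEdges (G : SimpleGraph V) [G.LocallyFinite] (Λ : Finset V) : Finset (Sym2 V) :=
  Λ.biUnion fun v => G.incidenceFinset v

/-- The number of monochromatic edges of `σ` among the edges touching `Λ`
(an edge `{u, v}` is monochromatic iff its image `{σ u, σ v}` is a diagonal pair). -/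
def monoEdges (G : SimpleGraph V) [G.LocallyFinite] (Λ : Finset V) (σ : Config V) : ℕ :=
  ((touchingEdges G Λ).filter fun e => (e.map σ).IsDiag).card

/-- The unnormalised Ising weight of `σ` in the volume `Λ`, at inverse temperature `β` with
external field `h`. -/
def weight (G : SimpleGraph V) [G.LocallyFinite] (β h : ℝ) (Λ : Finset V) (σ : Config V) : ℝ :=
  Real.exp (h * ∑ v ∈ Λ, spin σ v + β * (monoEdges G Λ σ : ℝ))

/-- The partition function in the volume `Λ` with boundary condition `ξ`. -/
def partitionFn (G : SimpleGraph V) [G.LocallyFinite] (β h : ℝ) (Λ : Finset V) (ξ : Config V) :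
    ℝ :=
  ∑ τ : Λ → ℤˣ, weight G β h Λ (glue Λ τ ξ)

/-- The finite-volume Ising distribution in `Λ` with boundary condition `ξ` off `Λ`. -/
def finiteVolume (G : SimpleGraph V) [G.LocallyFinite] (β h : ℝ) (Λ : Finset V) (ξ : Config V) :
    Measure (Config V) :=
  ∑ τ : Λ → ℤˣ,
    ENNReal.ofReal (weight G β h Λ (glue Λ τ ξ) / partitionFn G β h Λ ξ) •
      Measure.dirac (glue Λ τ ξ)

/-- `ν` is an Ising (Gibbs) measure on `G`: a probability measure that satisfies the
Dobrushin--Lanford--Ruelle equations for every finite volume. -/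
def IsGibbs (G : SimpleGraph V) [G.LocallyFinite] (β h : ℝ) (ν : Measure (Config V)) : Prop :=
  IsProbabilityMeasure ν ∧
    ∀ (Λ : Finset V) (A : Set (Config V)), MeasurableSet A →
      ν A = ∫⁻ ξ, finiteVolume G β h Λ ξ A ∂ν

/-- The magnetization `E_ν[σ_v]` at the vertex `v`. -/
def magnetization (ν : Measure (Config V)) (v : V) : ℝ := ∫ σ, spin σ v ∂ν

/-- Translation invariance, in the sense that the single-vertex magnetization is constant. -/
def IsTranslationInvariant (ν : Measure (Config V)) : Prop :=
  ∀ v w : V, magnetization ν v = magnetization ν w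

/-- `ν` arises from a broadcast process on the tree `G` (it is a tree-indexed Markov chain): there
are a root `o`, an initial law `p` of the spin at `o`, and for every vertex `v ≠ o`, with parent
`pa v`, a transition matrix `K v` from the spin of `pa v` to the spin of `v`, such that the
probability of seeing `ξ` on a finite subtree `Λ` containing `o` is the product of the initial
probability and the transition probabilities along the edges of `Λ`.
The transition matrix is allowed to vary from edge to edge. -/
def IsBroadcast (G : SimpleGraph V) (ν : Measure (Config V)) : Prop :=
  ∃ (o : V) (pa : V → V) (p : PMF ℤˣ) (K : V → ℤˣ → PMF ℤˣ),
    (∀ v, v ≠ o → G.Adj (pa v) v ∧ G.dist o v = G.dist o (pa v) + 1) ∧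
    ∀ Λ : Finset V, o ∈ Λ → (∀ v ∈ Λ, v ≠ o → pa v ∈ Λ) → ∀ ξ : Config V,
      ν {σ | ∀ v ∈ Λ, σ v = ξ v} = p (ξ o) * ∏ v ∈ Λ.erase o, K v (ξ (pa v)) (ξ v)

/-- The translation-invariant Ising Gibbs measures on the tree `G` with inverse temperature `β` and
external field `h`, among the Gibbs measures arising from broadcast processes. -/
def invariantIsing (G : SimpleGraph V) [G.LocallyFinite] (β h : ℝ) : Set (Measure (Config V)) :=
  {ν | IsGibbs G β h ν ∧ IsBroadcast G ν ∧ IsTranslationInvariant ν}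

end TreeIsing

end

/-! Let `q = (1 + η) / 2`, the common probability of the spin `1`. The Gibbs property and the
constancy of the magnetization together determine every transition matrix of the broadcast process.

Uniqueness. For a broadcast measure, comparing the four spin patterns on an edge through the
single-site DLR equation shows that the matrix into each vertex has odds ratio `exp (2 * β)`,
whatever the field (`IsGibbs.odds_ratio`). Constant magnetization makes the matrix preserve `(q, 1 -
q)`, so the joint law of the edge has equal marginals and is symmetric, with one free entry `x`; the
odds ratio fixes `x` (`eq_transition`). All matrices therefore coincide, and the chain is
reversible, so its law does not depend on the root (`HasChainLaw.measure_unique`). A Gibbs measure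
has full support, and the cost of one spin flip reveals its field (`IsGibbs.field_unique`).

Existence. The reversible chain with this `x` is built from independent innovations
(`exists_broadcast`). Its cylinder probabilities are products over vertices and edges. In
exponential form the edge factor is the Ising interaction times a field on the two endpoints; since
each vertex has `d` edges, these fields add up to a constant one (`HasChainLaw.exists_isGibbs`). -/

namespace TreeIsing

/-! ### Parent maps, balls and rooted subtrees of a tree. -/

section

variable {V : Type*}

/-- `pa` maps every vertex `v ≠ o` to a neighbour of `v` that is closer to `o`. -/
def IsParent (G : SimpleGraph V) (o : V) (pa : V → V) : Prop :=
  ∀ v, v ≠ o → G.Adj (pa v) v ∧ G.dist o v = G.dist o (pa v) + 1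

theorem exists_isParent {G : SimpleGraph V} (hG : G.Connected) (o : V) :
    ∃ pa : V → V, IsParent G o pa ∧ pa o = o := by
  classical
  have key : ∀ v, v ≠ o → ∃ u, G.Adj u v ∧ G.dist o v = G.dist o u + 1 := by
    intro v hv
    obtain ⟨p, hp⟩ := hG.exists_walk_length_eq_dist v o
    cases p with
    | nil => exact absurd rfl hv
    | @cons _ u _ hadj q =>
      refine ⟨u, hadj.symm, ?_⟩
      have h1 : G.dist u o ≤ q.length := SimpleGraph.dist_le q
      have h2 : G.dist v o ≤ G.dist v u + G.dist u o := hG.dist_triangle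
      have h3 : G.dist v u = 1 := SimpleGraph.dist_eq_one_iff_adj.2 hadj
      rw [SimpleGraph.Walk.length_cons] at hp
      rw [SimpleGraph.dist_comm (u := o) (v := v), SimpleGraph.dist_comm (u := o) (v := u)]
      omega
  choose! f hf using key
  refine ⟨fun v => if v = o then o else f v, fun v hv => ?_, by simp⟩
  simpa [hv] using hf v hv

/-- Geodesics from `o` to `u` and to `pa v`, each prolonged to `v`, are paths to `v`. A tree has
only one such path, so the penultimate vertices agree. -/
theorem IsParent.eq_of_adj {G : SimpleGraph V} (hG : G.IsTree) {o : V} {pa : V → V}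
    (hpa : IsParent G o pa) {u v : V} (huv : G.Adj u v) (hd : G.dist o v = G.dist o u + 1) :
    v ≠ o ∧ pa v = u := by
  have hv : v ≠ o := by
    rintro rfl
    simp at hd
  refine ⟨hv, ?_⟩
  obtain ⟨hadj, hd'⟩ := hpa v hv
  obtain ⟨p, -, hp⟩ := hG.connected.exists_path_of_dist o u
  have hq : (p.concat huv).IsPath := by
    apply SimpleGraph.Walk.isPath_of_length_eq_dist
    rw [SimpleGraph.Walk.length_concat, hp, hd]
  obtain ⟨p', -, hp'⟩ := hG.connected.exists_path_of_dist o (pa v)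
  have hq' : (p'.concat hadj).IsPath := by
    apply SimpleGraph.Walk.isPath_of_length_eq_dist
    rw [SimpleGraph.Walk.length_concat, hp', hd']
  have := (hG.isAcyclic.subsingleton_path o v).elim ⟨_, hq⟩ ⟨_, hq'⟩
  have h := congrArg (fun r : G.Path o v => (r : G.Walk o v).penultimate) this
  simpa using h.symm

theorem IsParent.adj_cases {G : SimpleGraph V} (hG : G.IsTree) {o : V} {pa : V → V}
    (hpa : IsParent G o pa) {u v : V} (huv : G.Adj u v) :
    (v ≠ o ∧ pa v = u) ∨ (u ≠ o ∧ pa u = v) := by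
  rcases hG.dist_eq_dist_add_one_of_adj o huv with h | h
  · exact Or.inr (hpa.eq_of_adj hG huv.symm h)
  · exact Or.inl (hpa.eq_of_adj hG huv h)

/-- The cylinder set of the configurations that agree with `ξ` on `Λ`. -/
def cyl (Λ : Finset V) (ξ : Config V) : Set (Config V) := {σ | ∀ v ∈ Λ, σ v = ξ v}

instance : DiscreteMeasurableSpace ℤˣ := ⟨measurableSet_spins⟩

theorem measurableSet_cyl (Λ : Finset V) (ξ : Config V) : MeasurableSet (cyl Λ ξ) := by
  have : cyl Λ ξ = ⋂ v ∈ Λ, (fun σ : Config V => σ v) ⁻¹' {ξ v} := by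
    ext σ
    simp [cyl]
  rw [this]
  exact Finset.measurableSet_biInter _ fun v _ =>
    measurable_pi_apply v (measurableSet_spins _)

variable [DecidableEq V]

/-- The ball of radius `n` about `o`, as a finite set. -/
def finBall (G : SimpleGraph V) [G.LocallyFinite] (o : V) : ℕ → Finset V
  | 0 => {o}
  | n + 1 => finBall G o n ∪ (finBall G o n).biUnion fun v => G.neighborFinset v

theorem mem_finBall {G : SimpleGraph V} [G.LocallyFinite] (hG : G.Connected) {o v : V} {n : ℕ} :
    v ∈ finBall G o n ↔ G.dist o v ≤ n := by
  induction n generalizing v with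
  | zero => simp [finBall, hG.dist_eq_zero_iff, eq_comm]
  | succ n ih =>
    simp only [finBall, Finset.mem_union, Finset.mem_biUnion, SimpleGraph.mem_neighborFinset, ih]
    constructor
    · rintro (h | ⟨u, hu, huv⟩)
      · omega
      · have h2 : G.dist o v ≤ G.dist o u + G.dist u v := hG.dist_triangle
        rw [SimpleGraph.dist_eq_one_iff_adj.2 huv] at h2
        omega
    · intro h
      by_cases hv : v = o
      · left
        simp [hv]
      · obtain ⟨pa, hpa, -⟩ := exists_isParent hG o
        obtain ⟨h1, h2⟩ := hpa v hv
        exact Or.inr ⟨pa v, by omega, h1⟩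

theorem exists_subset_finBall {G : SimpleGraph V} [G.LocallyFinite] (hG : G.Connected) (o : V)
    (S : Finset V) (m : ℕ) : ∃ n, m ≤ n ∧ S ⊆ finBall G o n := by
  refine ⟨max m (S.sup (G.dist o)), le_max_left _ _, fun v hv => ?_⟩
  rw [mem_finBall hG]
  exact le_max_of_le_right (Finset.le_sup (f := G.dist o) hv)

/-- `Λ` contains the root and is closed under `pa`, i.e. is a finite subtree containing `o`. -/
def IsClosedUnder (o : V) (pa : V → V) (Λ : Finset V) : Prop :=
  o ∈ Λ ∧ ∀ v ∈ Λ, v ≠ o → pa v ∈ Λ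

theorem IsParent.isClosedUnder_finBall {G : SimpleGraph V} [G.LocallyFinite] (hG : G.Connected)
    {o : V} {pa : V → V} (hpa : IsParent G o pa) (n : ℕ) :
    IsClosedUnder o pa (finBall G o n) := by
  refine ⟨by simp [mem_finBall hG], fun v hv hvo => ?_⟩
  rw [mem_finBall hG] at hv ⊢
  have := (hpa v hvo).2
  omega

theorem IsParent.isClosedUnder_finBall_of_dist_le {G : SimpleGraph V} [G.LocallyFinite]
    (hG : G.IsTree) {o o' : V} {pa : V → V} (hpa : IsParent G o' pa) {n : ℕ}
    (hn : G.dist o o' ≤ n) : IsClosedUnder o' pa (finBall G o n) := by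
  obtain ⟨pb, hpb, -⟩ := exists_isParent hG.connected o
  -- Here `pa` points to `o'` and `pb` to `o`. Once the route to `o'` moves away from `o`, it does
  -- so at every later step, so no distance on it exceeds that of `o'`.
  have key : ∀ k v, G.dist o' v = k → v ≠ o' → pb (pa v) = v → pa v ≠ o →
      G.dist o (pa v) ≤ n := by
    intro k
    induction k with
    | zero =>
      intro v hv hvo
      exact absurd ((hG.connected.dist_eq_zero_iff).1 hv).symm hvo
    | succ k ih =>
      intro v hv hvo hpv hw
      obtain ⟨h1, h2⟩ := hpa v hvo
      by_cases hwo : pa v = o'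
      · rwa [hwo]
      · obtain ⟨h3, h4⟩ := hpa _ hwo
        have hne : pa (pa v) ≠ v := by
          intro h
          rw [h] at h4
          omega
        rcases hpb.adj_cases hG h3 with ⟨-, h⟩ | ⟨h, h'⟩
        · exact absurd (h.symm.trans hpv) hne
        · have h5 := ih (pa v) (by omega) hwo h' h
          have h6 := (hpb _ h).2
          rw [h'] at h6
          omega
  refine ⟨by rwa [mem_finBall hG.connected], fun v hv hvo => ?_⟩
  rw [mem_finBall hG.connected] at hv ⊢
  rcases hpb.adj_cases hG (hpa v hvo).1 with ⟨h, h'⟩ | ⟨h, h'⟩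
  · have := (hpb v h).2
    rw [h'] at this
    omega
  · exact key _ v rfl hvo h' h

/-- The edges between a vertex of `Λ` other than the root and its parent. -/
def parentEdges (o : V) (pa : V → V) (Λ : Finset V) : Finset (Sym2 V) :=
  (Λ.erase o).image fun v => s(pa v, v)

theorem IsParent.injOn_edge {G : SimpleGraph V} {o : V} {pa : V → V} (hpa : IsParent G o pa)
    {v w : V} (hv : v ≠ o) (hw : w ≠ o) (h : s(pa v, v) = s(pa w, w)) : v = w := by
  rcases Sym2.eq_iff.1 h with h | h
  · exact h.2
  · have h1 := (hpa v hv).2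
    have h2 := (hpa w hw).2
    rw [h.1] at h1
    rw [← h.2] at h2
    omega

theorem IsParent.prod_parentEdges {G : SimpleGraph V} {o : V} {pa : V → V}
    (hpa : IsParent G o pa) (Λ : Finset V) {M : Type*} [CommMonoid M] (f : Sym2 V → M) :
    ∏ e ∈ parentEdges o pa Λ, f e = ∏ v ∈ Λ.erase o, f s(pa v, v) := by
  unfold parentEdges
  rw [Finset.prod_image]
  intro v hv w hw h
  exact hpa.injOn_edge (Finset.ne_of_mem_erase hv) (Finset.ne_of_mem_erase hw) h

/-- The right-hand side mentions neither root nor parent map, so the edge set is the same for every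
admissible root. -/
theorem IsParent.mk_mem_parentEdges {G : SimpleGraph V} (hG : G.IsTree) {o : V} {pa : V → V}
    (hpa : IsParent G o pa) {Λ : Finset V} (hΛ : IsClosedUnder o pa Λ) {u v : V} :
    s(u, v) ∈ parentEdges o pa Λ ↔ G.Adj u v ∧ u ∈ Λ ∧ v ∈ Λ := by
  unfold parentEdges
  simp only [Finset.mem_image, Finset.mem_erase]
  constructor
  · rintro ⟨w, ⟨hwo, hw⟩, h⟩
    have h1 := (hpa w hwo).1
    have h2 := hΛ.2 w hw hwo
    rcases Sym2.eq_iff.1 h with ⟨rfl, rfl⟩ | ⟨rfl, rfl⟩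
    · exact ⟨h1, h2, hw⟩
    · exact ⟨h1.symm, hw, h2⟩
  · rintro ⟨h, hu, hv⟩
    rcases hpa.adj_cases hG h with ⟨h1, rfl⟩ | ⟨h1, rfl⟩
    · exact ⟨v, ⟨h1, hv⟩, rfl⟩
    · exact ⟨u, ⟨h1, hu⟩, Sym2.eq_swap⟩

theorem parentEdges_eq_parentEdges {G : SimpleGraph V} (hG : G.IsTree) {o o' : V} {pa pa' : V → V}
    (hpa : IsParent G o pa) (hpa' : IsParent G o' pa') {Λ : Finset V}
    (hΛ : IsClosedUnder o pa Λ) (hΛ' : IsClosedUnder o' pa' Λ) :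
    parentEdges o pa Λ = parentEdges o' pa' Λ := by
  ext e
  induction e with
  | _ u v => rw [hpa.mk_mem_parentEdges hG hΛ, hpa'.mk_mem_parentEdges hG hΛ']

end

/-! ### Cylinder sets and tree-indexed Markov chains. -/

section

variable {V : Type*}

theorem inter_cyl_of_subset {S T : Finset V} (hST : S ⊆ T) (ξ ξ' : Config V) :
    (cyl S ξ ∩ cyl T ξ' = cyl T ξ' ∧ ∀ v ∈ S, ξ' v = ξ v) ∨ cyl S ξ ∩ cyl T ξ' = ∅ := by
  by_cases h : ∀ v ∈ S, ξ' v = ξ v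
  · refine Or.inl ⟨Set.inter_eq_right.2 fun σ hσ v hv => ?_, h⟩
    rw [hσ v (hST hv), h v hv]
  · refine Or.inr (Set.eq_empty_iff_forall_notMem.2 fun σ hσ => h fun v hv => ?_)
    rw [← hσ.1 v hv, hσ.2 v (hST hv)]

theorem cyl_congr {T : Finset V} {ξ ξ' : Config V} (h : ∀ v ∈ T, ξ v = ξ' v) :
    cyl T ξ = cyl T ξ' := by
  ext σ
  exact forall₂_congr fun v hv => by rw [h v hv]

theorem measurableSet_spin_eq (v : V) (a : ℤˣ) : MeasurableSet {σ : Config V | σ v = a} := by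
  have h : {σ : Config V | σ v = a} = (fun σ : Config V => σ v) ⁻¹' {a} := by
    ext σ
    simp
  rw [h]
  exact measurable_pi_apply v (measurableSet_spins _)

theorem spin_eq_ite (σ : Config V) (v : V) : spin σ v = if σ v = 1 then 1 else -1 := by
  unfold spin
  rcases Int.units_eq_one_or (σ v) with h | h <;> simp [h]

theorem real_one_add_real_neg_one (ν : Measure (Config V)) [IsProbabilityMeasure ν] (v : V) :
    ν.real {σ | σ v = 1} + ν.real {σ | σ v = -1} = 1 := by
  have hm := measurableSet_spin_eq v 1
  have h : {σ : Config V | σ v = 1}ᶜ = {σ | σ v = -1} := by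
    ext σ
    rcases Int.units_eq_one_or (σ v) with h | h <;> simp [h]
  rw [← h, probReal_compl_eq_one_sub hm]
  ring

theorem magnetization_eq (ν : Measure (Config V)) [IsProbabilityMeasure ν] (v : V) :
    magnetization ν v = 2 * ν.real {σ | σ v = 1} - 1 := by
  have hm := measurableSet_spin_eq v 1
  have h : ∀ σ : Config V, spin σ v = 2 * Set.indicator {σ : Config V | σ v = 1} 1 σ - 1 := by
    intro σ
    rw [spin_eq_ite]
    by_cases h : σ v = 1
    · simp [h]; norm_num
    · simp [h]
  unfold magnetization
  simp_rw [h]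
  rw [integral_sub _ (integrable_const _), integral_const_mul, integral_indicator_one hm]
  · simp
  · exact ((integrable_const (1 : ℝ)).indicator hm).const_mul 2

variable [DecidableEq V]

theorem glue_of_mem {Λ : Finset V} (τ : Λ → ℤˣ) (ξ : Config V) {v : V} (hv : v ∈ Λ) :
    glue Λ τ ξ v = τ ⟨v, hv⟩ := dif_pos hv

theorem glue_of_notMem {Λ : Finset V} (τ : Λ → ℤˣ) (ξ : Config V) {v : V} (hv : v ∉ Λ) :
    glue Λ τ ξ v = ξ v := dif_neg hv

theorem mem_cyl_glue {T : Finset V} {τ : T → ℤˣ} {ξ σ : Config V} :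
    σ ∈ cyl T (glue T τ ξ) ↔ T.restrict σ = τ := by
  constructor
  · intro h
    funext v
    rw [Finset.restrict, h v v.2, glue_of_mem _ _ v.2]
  · rintro rfl v hv
    rw [glue_of_mem _ _ hv, Finset.restrict]

/-- The filler `1` is immaterial: a cylinder over `T` only reads the values on `T`. -/
theorem measure_eq_sum_cyl (ν : Measure (Config V)) (T : Finset V) (S : Set (Config V)) :
    ν S = ∑ τ : T → ℤˣ, ν (S ∩ cyl T (glue T τ 1)) := by
  have h1 : (⋃ τ ∈ (Finset.univ : Finset (T → ℤˣ)), cyl T (glue T τ 1)) = Set.univ := by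
    refine Set.eq_univ_of_forall fun σ => ?_
    simp only [Set.mem_iUnion, Finset.mem_univ, exists_true_left, mem_cyl_glue]
    exact ⟨_, rfl⟩
  have h2 := measure_biUnion_finset (μ := ν.restrict S) (s := (Finset.univ : Finset (T → ℤˣ)))
    (f := fun τ => cyl T (glue T τ 1)) (fun τ _ τ' _ hne => by
      refine Set.disjoint_left.2 fun σ h h' => hne ?_
      rw [mem_cyl_glue] at h h'
      exact h.symm.trans h') (fun τ _ => measurableSet_cyl _ _)
  rw [h1, Measure.restrict_apply_univ] at h2
  rw [h2]
  refine Finset.sum_congr rfl fun τ _ => ?_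
  rw [Measure.restrict_apply (measurableSet_cyl _ _), Set.inter_comm]

theorem real_eq_sum_cyl (ν : Measure (Config V)) [IsFiniteMeasure ν] (T : Finset V)
    (S : Set (Config V)) : ν.real S = ∑ τ : T → ℤˣ, ν.real (S ∩ cyl T (glue T τ 1)) := by
  rw [measureReal_def, measure_eq_sum_cyl ν T, ENNReal.toReal_sum fun _ _ => measure_ne_top _ _]
  rfl

/-- A finite measure is determined by its values on the cylinders over a cofinal family of finite
sets. -/
theorem ext_of_cyl {ν ν' : Measure (Config V)} [IsFiniteMeasure ν]
    (h : ∀ S : Finset V, ∃ T, S ⊆ T ∧ ∀ ξ, ν (cyl T ξ) = ν' (cyl T ξ)) : ν = ν' := by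
  have h1 : ∀ (S : Finset V) (ξ : Config V), ν (cyl S ξ) = ν' (cyl S ξ) := by
    intro S ξ
    obtain ⟨T, hST, hT⟩ := h S
    rw [measure_eq_sum_cyl ν T, measure_eq_sum_cyl ν' T]
    refine Finset.sum_congr rfl fun τ _ => ?_
    rcases inter_cyl_of_subset hST ξ (glue T τ 1) with ⟨h, -⟩ | h
    · rw [h, hT]
    · rw [h, measure_empty, measure_empty]
  have h2 : ∀ S : Finset V, ν.map S.restrict = ν'.map S.restrict := by
    intro S
    refine Measure.ext_of_singleton fun τ => ?_
    have h3 : S.restrict ⁻¹' ({τ} : Set (S → ℤˣ)) = cyl S (glue S τ 1) := by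
      ext σ
      rw [mem_cyl_glue]
      rfl
    rw [Measure.map_apply (Finset.measurable_restrict S) (measurableSet_singleton τ),
      Measure.map_apply (Finset.measurable_restrict S) (measurableSet_singleton τ), h3, h1]
  exact IsProjectiveLimit.unique (P := fun S : Finset V => ν.map S.restrict) (fun S => rfl)
    fun S => (h2 S).symm

/-- The cylinder probabilities of `ν` are those of the tree-indexed Markov chain with root `o`,
initial weights `P` and transition weights `k`. -/
def HasChainLaw (ν : Measure (Config V)) (o : V) (pa : V → V) (P : ℤˣ → ℝ)
    (k : V → ℤˣ → ℤˣ → ℝ) : Prop :=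
  ∀ Λ : Finset V, IsClosedUnder o pa Λ → ∀ ξ : Config V,
    ν.real (cyl Λ ξ) = P (ξ o) * ∏ v ∈ Λ.erase o, k v (ξ (pa v)) (ξ v)

theorem HasChainLaw.root {ν : Measure (Config V)} {o : V} {pa : V → V} {P : ℤˣ → ℝ}
    {k : V → ℤˣ → ℤˣ → ℝ} (hν : HasChainLaw ν o pa P k) (a : ℤˣ) :
    ν.real {σ | σ o = a} = P a := by
  have := hν {o} ⟨by simp, fun v hv h => absurd (by simpa using hv) h⟩ (fun _ => a)
  simpa [cyl] using this

theorem HasChainLaw.joint {G : SimpleGraph V} [G.LocallyFinite] (hG : G.Connected)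
    {ν : Measure (Config V)} [IsFiniteMeasure ν] {o : V} {pa : V → V} (hpa : IsParent G o pa)
    {P : ℤˣ → ℝ} {k : V → ℤˣ → ℤˣ → ℝ} (hν : HasChainLaw ν o pa P k) {v : V} (hv : v ≠ o)
    (a b : ℤˣ) :
    ν.real ({σ | σ (pa v) = a} ∩ {σ | σ v = b}) = ν.real {σ | σ (pa v) = a} * k v a b := by
  obtain ⟨-, hd⟩ := hpa v hv
  -- This radius makes `B` contain `pa v` but not `v`, so adjoining `v` multiplies each cylinder
  -- probability by a single transition weight.
  set B := finBall G o (G.dist o (pa v)) with hB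
  have hBc : IsClosedUnder o pa B := hpa.isClosedUnder_finBall hG _
  have hpB : pa v ∈ B := by rw [hB, mem_finBall hG]
  have hvB : v ∉ B := by rw [hB, mem_finBall hG]; omega
  have hBc' : IsClosedUnder o pa (insert v B) := by
    refine ⟨Finset.mem_insert_of_mem hBc.1, fun w hw hwo => ?_⟩
    rcases Finset.mem_insert.1 hw with rfl | hw
    · exact Finset.mem_insert_of_mem hpB
    · exact Finset.mem_insert_of_mem (hBc.2 w hw hwo)
  rw [real_eq_sum_cyl ν B, real_eq_sum_cyl ν B {σ | σ (pa v) = a}, Finset.sum_mul]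
  refine Finset.sum_congr rfl fun τ _ => ?_
  set ξ := glue B τ 1
  by_cases hξ : ξ (pa v) = a
  · have h1 : {σ | σ (pa v) = a} ∩ {σ | σ v = b} ∩ cyl B ξ
        = cyl (insert v B) (Function.update ξ v b) := by
      ext σ
      constructor
      · rintro ⟨⟨-, h⟩, h'⟩ w hw
        rcases Finset.mem_insert.1 hw with rfl | hw
        · rw [Function.update_self]
          exact h
        · rw [Function.update_of_ne (by rintro rfl; exact hvB hw), h' w hw]
      · intro h
        have h' : σ ∈ cyl B ξ := fun w hw => by
          rw [h w (Finset.mem_insert_of_mem hw),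
            Function.update_of_ne (by rintro rfl; exact hvB hw)]
        refine ⟨⟨?_, ?_⟩, h'⟩
        · rw [Set.mem_ofPred_eq, h' _ hpB, hξ]
        · rw [Set.mem_ofPred_eq, h v (Finset.mem_insert_self _ _), Function.update_self]
    have h2 : {σ | σ (pa v) = a} ∩ cyl B ξ = cyl B ξ :=
      Set.inter_eq_right.2 fun σ hσ => by rw [Set.mem_ofPred_eq, hσ _ hpB, hξ]
    have hne : ∀ w ∈ B, w ≠ v := fun w hw => by rintro rfl; exact hvB hw
    rw [h1, h2, hν _ hBc', hν _ hBc, Finset.erase_insert_of_ne hv,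
      Finset.prod_insert (fun h => hvB (Finset.mem_of_mem_erase h)), Function.update_self,
      Function.update_of_ne (hne _ hpB), Function.update_of_ne (hne _ hBc.1), hξ]
    have h3 : ∏ w ∈ B.erase o, k w (Function.update ξ v b (pa w)) (Function.update ξ v b w)
        = ∏ w ∈ B.erase o, k w (ξ (pa w)) (ξ w) := by
      refine Finset.prod_congr rfl fun w hw => ?_
      obtain ⟨hwo, hwB⟩ := Finset.mem_erase.1 hw
      rw [Function.update_of_ne (hne _ (hBc.2 w hwB hwo)), Function.update_of_ne (hne _ hwB)]
    rw [h3]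
    ring
  · have h2 : {σ | σ (pa v) = a} ∩ cyl B ξ = ∅ :=
      Set.eq_empty_iff_forall_notMem.2 fun σ hσ => hξ ((hσ.2 _ hpB).symm.trans hσ.1)
    have h1 : {σ | σ (pa v) = a} ∩ {σ | σ v = b} ∩ cyl B ξ = ∅ :=
      Set.eq_empty_iff_forall_notMem.2 fun σ hσ => hξ ((hσ.2 _ hpB).symm.trans hσ.1.1)
    rw [h1, h2]
    simp

end

/-! ### The DLR equations on cylinders. -/

section

variable {V : Type*} [DecidableEq V]

theorem mk_mem_touchingEdges {G : SimpleGraph V} [G.LocallyFinite] {Λ : Finset V} {u v : V} :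
    s(u, v) ∈ touchingEdges G Λ ↔ G.Adj u v ∧ (u ∈ Λ ∨ v ∈ Λ) := by
  simp only [touchingEdges, Finset.mem_biUnion, SimpleGraph.mem_incidenceFinset,
    SimpleGraph.incidenceSet, Set.mem_ofPred_eq, SimpleGraph.mem_edgeSet, Sym2.mem_iff]
  constructor
  · rintro ⟨w, hw, h, rfl | rfl⟩
    · exact ⟨h, Or.inl hw⟩
    · exact ⟨h, Or.inr hw⟩
  · rintro ⟨h, hw | hw⟩
    · exact ⟨u, hw, h, Or.inl rfl⟩
    · exact ⟨v, hw, h, Or.inr rfl⟩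

/-- `Λ'` contains `Λ` and all the neighbours of vertices of `Λ`. -/
def ContainsNbhd (G : SimpleGraph V) (Λ Λ' : Finset V) : Prop :=
  ∀ v ∈ Λ, v ∈ Λ' ∧ ∀ w, G.Adj v w → w ∈ Λ'

theorem containsNbhd_finBall {G : SimpleGraph V} [G.LocallyFinite] {o : V} {n : ℕ} {Λ : Finset V}
    (h : Λ ⊆ finBall G o n) : ContainsNbhd G Λ (finBall G o (n + 1)) := by
  intro v hv
  simp only [finBall, Finset.mem_union, Finset.mem_biUnion, SimpleGraph.mem_neighborFinset]
  exact ⟨Or.inl (h hv), fun w hw => Or.inr ⟨v, h hv, hw⟩⟩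

theorem weight_congr {G : SimpleGraph V} [G.LocallyFinite] (β h : ℝ) {Λ Λ' : Finset V}
    (hΛ : ContainsNbhd G Λ Λ') {σ σ' : Config V} (hσ : ∀ v ∈ Λ', σ v = σ' v) :
    weight G β h Λ σ = weight G β h Λ σ' := by
  have h1 : ∀ v ∈ Λ, spin σ v = spin σ' v := fun v hv => by
    simp only [spin, hσ v (hΛ v hv).1]
  have h2 : monoEdges G Λ σ = monoEdges G Λ σ' := by
    unfold monoEdges
    congr 1
    refine Finset.filter_congr fun e he => ?_
    induction e with
    | _ u v =>
      obtain ⟨hadj, hu | hv⟩ := mk_mem_touchingEdges.1 he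
      · rw [Sym2.map_mk, Sym2.map_mk, hσ u (hΛ u hu).1, hσ v ((hΛ u hu).2 v hadj)]
      · rw [Sym2.map_mk, Sym2.map_mk, hσ v (hΛ v hv).1, hσ u ((hΛ v hv).2 u hadj.symm)]
  unfold weight
  rw [Finset.sum_congr rfl h1, h2]

theorem weight_pos (G : SimpleGraph V) [G.LocallyFinite] (β h : ℝ) (Λ : Finset V) (σ : Config V) :
    0 < weight G β h Λ σ := Real.exp_pos _

theorem partitionFn_pos (G : SimpleGraph V) [G.LocallyFinite] (β h : ℝ) (Λ : Finset V)
    (ξ : Config V) : 0 < partitionFn G β h Λ ξ :=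
  Finset.sum_pos (fun _ _ => weight_pos _ _ _ _ _) Finset.univ_nonempty

theorem glue_congr {Λ Λ' : Finset V} (τ : Λ → ℤˣ) {ξ ζ : Config V} (h : ζ ∈ cyl (Λ' \ Λ) ξ) :
    ∀ v ∈ Λ', glue Λ τ ζ v = glue Λ τ ξ v := by
  intro v hv
  by_cases hvΛ : v ∈ Λ
  · rw [glue_of_mem _ _ hvΛ, glue_of_mem _ _ hvΛ]
  · rw [glue_of_notMem _ _ hvΛ, glue_of_notMem _ _ hvΛ, h v (Finset.mem_sdiff.2 ⟨hv, hvΛ⟩)]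

theorem partitionFn_congr {G : SimpleGraph V} [G.LocallyFinite] (β h : ℝ) {Λ Λ' : Finset V}
    (hΛ : ContainsNbhd G Λ Λ') {ξ ζ : Config V} (hζ : ζ ∈ cyl (Λ' \ Λ) ξ) :
    partitionFn G β h Λ ζ = partitionFn G β h Λ ξ :=
  Finset.sum_congr rfl fun τ _ => weight_congr β h hΛ (glue_congr τ hζ)

theorem glue_restrict (Λ : Finset V) (ξ : Config V) : glue Λ (Λ.restrict ξ) ξ = ξ := by
  funext v
  by_cases hv : v ∈ Λ
  · rw [glue_of_mem _ _ hv, Finset.restrict]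
  · rw [glue_of_notMem _ _ hv]

theorem glue_mem_cyl {Λ Λ' : Finset V} (hΛ : Λ ⊆ Λ') {τ : Λ → ℤˣ} {ζ ξ : Config V} :
    glue Λ τ ζ ∈ cyl Λ' ξ ↔ τ = Λ.restrict ξ ∧ ζ ∈ cyl (Λ' \ Λ) ξ := by
  constructor
  · intro h
    refine ⟨?_, fun v hv => ?_⟩
    · funext v
      rw [Finset.restrict, ← h v (hΛ v.2), glue_of_mem _ _ v.2]
    · obtain ⟨hv, hv'⟩ := Finset.mem_sdiff.1 hv
      rw [← h v hv, glue_of_notMem _ _ hv']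
  · rintro ⟨rfl, h⟩ v hv
    rw [glue_congr _ h v hv, glue_restrict]

theorem finiteVolume_apply (G : SimpleGraph V) [G.LocallyFinite] (β h : ℝ) (Λ : Finset V)
    (ζ : Config V) {A : Set (Config V)} (hA : MeasurableSet A) :
    finiteVolume G β h Λ ζ A = ∑ τ : Λ → ℤˣ,
      ENNReal.ofReal (weight G β h Λ (glue Λ τ ζ) / partitionFn G β h Λ ζ) *
        A.indicator 1 (glue Λ τ ζ) := by
  simp only [finiteVolume, Measure.coe_finsetSum, Finset.sum_apply, Measure.smul_apply,
    Measure.dirac_apply' _ hA, smul_eq_mul]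

/-- The boundary condition must already agree with `ξ` on `Λ' \ Λ`, and then only the filling
`Λ.restrict ξ` contributes. -/
theorem finiteVolume_cyl {G : SimpleGraph V} [G.LocallyFinite] (β h : ℝ) {Λ Λ' : Finset V}
    (hΛ : ContainsNbhd G Λ Λ') (ξ ζ : Config V) :
    finiteVolume G β h Λ ζ (cyl Λ' ξ) = (cyl (Λ' \ Λ) ξ).indicator
      (fun _ => ENNReal.ofReal (weight G β h Λ ξ / partitionFn G β h Λ ξ)) ζ := by
  have hsub : Λ ⊆ Λ' := fun v hv => (hΛ v hv).1
  rw [finiteVolume_apply _ _ _ _ _ (measurableSet_cyl _ _)]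
  by_cases hζ : ζ ∈ cyl (Λ' \ Λ) ξ
  · rw [Set.indicator_of_mem hζ, Finset.sum_eq_single (Λ.restrict ξ)]
    · rw [Set.indicator_of_mem ((glue_mem_cyl hsub).2 ⟨rfl, hζ⟩), Pi.one_apply, mul_one,
        weight_congr β h hΛ (glue_congr _ hζ), glue_restrict, partitionFn_congr β h hΛ hζ]
    · intro τ _ hτ
      rw [Set.indicator_of_notMem (fun h => hτ ((glue_mem_cyl hsub).1 h).1), mul_zero]
    · exact fun h => absurd (Finset.mem_univ _) h
  · rw [Set.indicator_of_notMem hζ]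
    refine Finset.sum_eq_zero fun τ _ => ?_
    rw [Set.indicator_of_notMem (fun h => hζ ((glue_mem_cyl hsub).1 h).2), mul_zero]

theorem lintegral_finiteVolume_cyl {G : SimpleGraph V} [G.LocallyFinite] (β h : ℝ)
    {Λ Λ' : Finset V} (hΛ : ContainsNbhd G Λ Λ') (ν : Measure (Config V)) (ξ : Config V) :
    ∫⁻ ζ, finiteVolume G β h Λ ζ (cyl Λ' ξ) ∂ν =
      ENNReal.ofReal (weight G β h Λ ξ / partitionFn G β h Λ ξ) * ν (cyl (Λ' \ Λ) ξ) := by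
  simp_rw [finiteVolume_cyl β h hΛ ξ]
  rw [lintegral_indicator (measurableSet_cyl _ _), setLIntegral_const]

/-- The ratio of the probabilities of two cylinders that differ only in `Λ` is the ratio of the
Ising weights. -/
theorem IsGibbs.cyl_mul_weight {G : SimpleGraph V} [G.LocallyFinite] {β h : ℝ}
    {ν : Measure (Config V)} (hν : IsGibbs G β h ν) {Λ Λ' : Finset V}
    (hΛ : ContainsNbhd G Λ Λ') {ξ ξ' : Config V} (hξ : ∀ v, v ∉ Λ → ξ v = ξ' v) :
    ν.real (cyl Λ' ξ) * weight G β h Λ ξ' = ν.real (cyl Λ' ξ') * weight G β h Λ ξ := by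
  -- Besides the weight, both factors depend on `ξ` only off `Λ`, so they cancel in the comparison.
  have key : ∀ ξ, ν.real (cyl Λ' ξ) =
      weight G β h Λ ξ / partitionFn G β h Λ ξ * ν.real (cyl (Λ' \ Λ) ξ) := by
    intro ξ
    rw [measureReal_def, hν.2 Λ _ (measurableSet_cyl _ _), lintegral_finiteVolume_cyl β h hΛ,
      ENNReal.toReal_mul, ENNReal.toReal_ofReal]
    · rfl
    · exact (div_pos (weight_pos _ _ _ _ _) (partitionFn_pos _ _ _ _ _)).le
  have h1 : ξ ∈ cyl (Λ' \ Λ) ξ' := fun v hv => hξ v (Finset.mem_sdiff.1 hv).2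
  rw [key ξ, key ξ', partitionFn_congr β h hΛ h1, cyl_congr h1]
  ring

/-- Finite energy: some cylinder over a larger ball has positive mass, and altering its spins on `T`
only multiplies the mass by a positive ratio of weights. -/
theorem IsGibbs.real_cyl_pos {G : SimpleGraph V} [G.LocallyFinite] (hG : G.Connected) {β h : ℝ}
    {ν : Measure (Config V)} (hν : IsGibbs G β h ν) (T : Finset V) (ξ : Config V) :
    0 < ν.real (cyl T ξ) := by
  have := hν.1
  obtain ⟨o⟩ := hG.nonempty
  obtain ⟨n, -, hn⟩ := exists_subset_finBall hG o T 0
  have hT := containsNbhd_finBall hn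
  set T' := finBall G o (n + 1)
  have h1 : ∑ τ : T' → ℤˣ, ν.real (Set.univ ∩ cyl T' (glue T' τ 1)) ≠ 0 := by
    rw [← real_eq_sum_cyl]
    simp
  obtain ⟨τ, -, hτ⟩ := Finset.exists_ne_zero_of_sum_ne_zero h1
  rw [Set.univ_inter] at hτ
  set ζ := glue T' τ 1
  set ζ' := glue T (T.restrict ξ) ζ with hζ'
  have h2 := hν.cyl_mul_weight hT (ξ := ζ) (ξ' := ζ') fun v hv => (glue_of_notMem _ _ hv).symm
  have h3 : 0 < ν.real (cyl T' ζ') := by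
    refine lt_of_le_of_ne measureReal_nonneg fun h0 => ?_
    rw [← h0, zero_mul] at h2
    exact (mul_ne_zero hτ (weight_pos _ _ _ _ _).ne') h2
  refine h3.trans_le (measureReal_mono fun σ hσ v hv => ?_)
  rw [hσ v (hT v hv).1, hζ', glue_of_mem _ _ hv, Finset.restrict]

theorem weight_singleton (G : SimpleGraph V) [G.LocallyFinite] (β h : ℝ) (v : V)
    (σ : Config V) : weight G β h {v} σ =
      Real.exp (h * spin σ v +
        β * ∑ w ∈ G.neighborFinset v, if σ v = σ w then (1 : ℝ) else 0) := by
  have h1 : touchingEdges G {v} = (G.neighborFinset v).image fun w => s(v, w) := by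
    ext e
    induction e with
    | _ a b =>
      simp only [mk_mem_touchingEdges, Finset.mem_singleton, Finset.mem_image,
        SimpleGraph.mem_neighborFinset]
      constructor
      · rintro ⟨h, rfl | rfl⟩
        · exact ⟨b, h, rfl⟩
        · exact ⟨a, h.symm, Sym2.eq_swap⟩
      · rintro ⟨w, h, he⟩
        rcases Sym2.eq_iff.1 he with ⟨rfl, rfl⟩ | ⟨rfl, rfl⟩
        · exact ⟨h, Or.inl rfl⟩
        · exact ⟨h.symm, Or.inr rfl⟩
  have h2 : (monoEdges G {v} σ : ℝ)
      = ∑ w ∈ G.neighborFinset v, if σ v = σ w then (1 : ℝ) else 0 := by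
    rw [monoEdges, h1, Finset.card_filter, Finset.sum_image (by simp)]
    push_cast
    refine Finset.sum_congr rfl fun w _ => ?_
    simp
  rw [weight, Finset.sum_singleton, h2]

/-- A measure is Gibbs for at most one value of the external field. -/
theorem IsGibbs.field_unique {G : SimpleGraph V} [G.LocallyFinite] (hG : G.Connected)
    {β h h' : ℝ} {ν : Measure (Config V)} (hν : IsGibbs G β h ν) (hν' : IsGibbs G β h' ν) :
    h = h' := by
  obtain ⟨o⟩ := hG.nonempty
  have hN : ContainsNbhd G {o} (finBall G o 1) := containsNbhd_finBall (by simp [finBall])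
  -- Flipping the spin at `o` in the all-`1` configuration changes the log-probability by `2 * h`
  -- plus a term in `β` alone.
  have hne : ∀ v, v ∉ ({o} : Finset V) → (1 : Config V) v = Function.update (1 : Config V) o (-1) v :=
    fun v hv => by rw [Function.update_of_ne (by simpa using hv)]
  have h1 := hν.cyl_mul_weight hN hne
  have h2 := hν'.cyl_mul_weight hN hne
  have p1 := hν.real_cyl_pos hG (finBall G o 1) 1
  have p2 := hν.real_cyl_pos hG (finBall G o 1) (Function.update 1 o (-1))
  set A := ν.real (cyl (finBall G o 1) 1)
  set B := ν.real (cyl (finBall G o 1) (Function.update 1 o (-1)))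
  simp only [weight_singleton, spin_eq_ite, Function.update_self, Pi.one_apply, if_true,
    show ((-1 : ℤˣ) = 1) = False by decide, if_false] at h1 h2
  set S := ∑ w ∈ G.neighborFinset o,
    if (-1 : ℤˣ) = Function.update (1 : Config V) o (-1) w then (1 : ℝ) else 0
  set S' := ∑ w ∈ G.neighborFinset o, (1 : ℝ)
  have e1 := congrArg Real.log h1
  have e2 := congrArg Real.log h2
  rw [Real.log_mul p1.ne' (Real.exp_pos _).ne', Real.log_mul p2.ne' (Real.exp_pos _).ne',
    Real.log_exp, Real.log_exp] at e1 e2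
  linarith

end

/-! ### Two-by-two tables and their odds ratios. -/

section

/-- The two-point law with weight `q` at `1`. -/
def marginal (q : ℝ) (a : ℤˣ) : ℝ := if a = 1 then q else 1 - q

/-- The symmetric table on `{±1}²` with marginals `marginal q` and off-diagonal entries `x`. -/
def jointTable (q x : ℝ) (a b : ℤˣ) : ℝ := if a = b then marginal q a - x else x

/-- The transition weights of the table `jointTable q x`. -/
noncomputable def transition (q x : ℝ) (a b : ℤˣ) : ℝ := jointTable q x a b / marginal q a

/-- The table `jointTable q x` is positive and has odds ratio `E`. -/
structure HasOddsRatio (q x E : ℝ) : Prop where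
  pos : 0 < x
  lt : x < q
  lt' : x < 1 - q
  eq : (q - x) * (1 - q - x) = E * x ^ 2

/-- Intermediate values: `E * x ^ 2 - (q - x) * (1 - q - x)` is negative at `0` and positive at `min
q (1 - q)`, where the product vanishes. -/
theorem exists_hasOddsRatio {q E : ℝ} (hq : 0 < q) (hq' : q < 1) (hE : 0 < E) :
    ∃ x, HasOddsRatio q x E := by
  set m := min q (1 - q) with hm
  have hm0 : 0 < m := lt_min hq (by linarith)
  have hcont : ContinuousOn (fun x : ℝ => E * x ^ 2 - (q - x) * (1 - q - x)) (Set.Icc 0 m) := by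
    fun_prop
  have h0 : E * (0 : ℝ) ^ 2 - (q - 0) * (1 - q - 0) < 0 := by nlinarith
  have h1 : 0 < E * m ^ 2 - (q - m) * (1 - q - m) := by
    have : (q - m) * (1 - q - m) = 0 := by
      rcases min_choice q (1 - q) with h | h <;> rw [hm, h] <;> ring
    rw [this, sub_zero]
    exact mul_pos hE (pow_pos hm0 2)
  obtain ⟨x, ⟨hx0, hxm⟩, hx⟩ := intermediate_value_Ioo hm0.le hcont ⟨h0, h1⟩
  exact ⟨x, hx0, hxm.trans_le (min_le_left _ _), hxm.trans_le (min_le_right _ _),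
    by simp only at hx; linarith⟩

/-- On `[0, min q (1 - q)]` the left side of the equation decreases and the right side strictly
increases. -/
theorem oddsRatio_unique {q E x y : ℝ} (hE : 0 < E) (hx : 0 ≤ x) (hxq : x ≤ q) (hxq' : x ≤ 1 - q)
    (hy : 0 ≤ y) (hyq : y ≤ q) (hyq' : y ≤ 1 - q) (ex : (q - x) * (1 - q - x) = E * x ^ 2)
    (ey : (q - y) * (1 - q - y) = E * y ^ 2) : x = y := by
  by_contra hne
  wlog hlt : x < y generalizing x y
  · exact this hy hyq hyq' hx hxq hxq' ey ex (Ne.symm hne)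
      (lt_of_le_of_ne (not_lt.1 hlt) (Ne.symm hne))
  have h1 : (q - y) * (1 - q - y) ≤ (q - x) * (1 - q - x) := by
    apply mul_le_mul <;> linarith
  have h2 : E * x ^ 2 < E * y ^ 2 := by gcongr
  linarith

/-- A stochastic `2 × 2` kernel preserving `marginal q` is determined by its odds ratio. -/
theorem eq_transition {q x E : ℝ} (hx : HasOddsRatio q x E) (hE : 0 < E) {k : ℤˣ → ℤˣ → ℝ}
    (hk : ∀ a b, 0 ≤ k a b) (hsum : ∀ a, k a 1 + k a (-1) = 1)
    (hinv : q * k 1 1 + (1 - q) * k (-1) 1 = q)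
    (hodds : k 1 1 * k (-1) (-1) = E * (k 1 (-1) * k (-1) 1)) : k = transition q x := by
  have hq : 0 < q := hx.pos.trans hx.lt
  have hq' : 0 < 1 - q := hx.pos.trans hx.lt'
  have s1 := hsum 1
  have s2 := hsum (-1)
  -- Stationarity on two points is detailed balance: the joint table is symmetric, with off-diagonal
  -- entry `q * k 1 (-1)`.
  have e1 : (1 - q) * k (-1) 1 = q * k 1 (-1) := by linear_combination hinv - q * s1
  have e2 : q * k 1 1 = q - q * k 1 (-1) := by linear_combination q * s1
  have e3 : (1 - q) * k (-1) (-1) = 1 - q - q * k 1 (-1) := by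
    linear_combination (1 - q) * s2 - e1
  have hxy : x = q * k 1 (-1) := by
    refine oddsRatio_unique hE hx.pos.le hx.lt.le hx.lt'.le (mul_nonneg hq.le (hk _ _)) ?_ ?_
      hx.eq ?_
    · have := mul_nonneg hq.le (hk 1 1)
      linarith
    · have := mul_nonneg hq'.le (hk (-1) (-1))
      linarith
    · rw [← e2, ← e3]
      linear_combination (q * (1 - q)) * hodds + E * q * k 1 (-1) * e1
  funext a b
  rcases Int.units_eq_one_or a with rfl | rfl <;> rcases Int.units_eq_one_or b with rfl | rfl <;>
    simp only [transition, jointTable, marginal, if_true, show ((-1 : ℤˣ) = 1) = False by decide,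
      show ((1 : ℤˣ) = -1) = False by decide, if_false, hxy] <;> rw [eq_div_iff (by positivity)]
  · linear_combination e2
  · ring
  · linear_combination e1
  · linear_combination e3

variable {V : Type*} [DecidableEq V]

/-- The single-site DLR equation at a vertex determines the odds ratio of the transition weights
into this vertex. -/
theorem IsGibbs.odds_ratio {G : SimpleGraph V} [G.LocallyFinite] (hG : G.Connected) {β h : ℝ}
    {ν : Measure (Config V)} (hν : IsGibbs G β h ν) {o : V} {pa : V → V} (hpa : IsParent G o pa)
    {P : ℤˣ → ℝ} {k : V → ℤˣ → ℤˣ → ℝ} (hc : HasChainLaw ν o pa P k) {v : V} (hv : v ≠ o) :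
    k v 1 1 * k v (-1) (-1) = Real.exp (2 * β) * (k v 1 (-1) * k v (-1) 1) := by
  obtain ⟨hadj, hd⟩ := hpa v hv
  set u := pa v with hu
  have huv : u ≠ v := hadj.ne
  set ξ : ℤˣ → ℤˣ → Config V := fun a b => Function.update (Function.update 1 u a) v b with hξ
  have ξv : ∀ a b, ξ a b v = b := fun a b => Function.update_self _ _ _
  have ξu : ∀ a b, ξ a b u = a := fun a b => by
    rw [hξ]
    simp only
    rw [Function.update_of_ne huv, Function.update_self]
  have ξw : ∀ a b w, w ≠ u → w ≠ v → ξ a b w = 1 := fun a b w h1 h2 => by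
    rw [hξ]
    simp only
    rw [Function.update_of_ne h2, Function.update_of_ne h1, Pi.one_apply]
  have ξnv : ∀ a b b' w, w ≠ v → ξ a b w = ξ a b' w := fun a b b' w h => by
    by_cases h' : w = u
    · rw [h', ξu, ξu]
    · rw [ξw _ _ _ h' h, ξw _ _ _ h' h]
  have ξnu : ∀ a a' b w, w ≠ u → ξ a b w = ξ a' b w := fun a a' b w h => by
    by_cases h' : w = v
    · rw [h', ξv, ξv]
    · rw [ξw _ _ _ h h', ξw _ _ _ h h']
  set B := finBall G o (G.dist o v + 1) with hB
  have hvB : v ∈ B.erase o := by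
    rw [Finset.mem_erase, hB, mem_finBall hG]
    exact ⟨hv, by omega⟩
  have hBc : IsClosedUnder o pa B := hpa.isClosedUnder_finBall hG _
  have hN : ContainsNbhd G {v} B := containsNbhd_finBall (by
    rw [Finset.singleton_subset_iff, mem_finBall hG])
  set C : ℤˣ → ℤˣ → ℝ := fun a b => ν.real (cyl B (ξ a b)) with hC
  have Cpos : ∀ a b, 0 < C a b := fun a b => hν.real_cyl_pos hG B (ξ a b)
  -- The chain factors other than the one of the edge from `u` to `v`. None depends on both spins,
  -- so their cross-ratio is `1`.
  set R : ℤˣ → ℤˣ → ℝ := fun a b =>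
    P (ξ a b o) * ∏ w ∈ (B.erase o).erase v, k w (ξ a b (pa w)) (ξ a b w) with hR
  have CR : ∀ a b, C a b = k v a b * R a b := fun a b => by
    rw [hC, hR]
    simp only
    rw [hc B hBc, ← Finset.mul_prod_erase _ _ hvB, ← hu, ξu, ξv]
    ring
  have hRcross : R 1 1 * R (-1) (-1) = R 1 (-1) * R (-1) 1 := by
    have h1 : ∏ w ∈ (B.erase o).erase v, k w (ξ 1 1 (pa w)) (ξ 1 1 w) *
          k w (ξ (-1) (-1) (pa w)) (ξ (-1) (-1) w)
        = ∏ w ∈ (B.erase o).erase v, k w (ξ 1 (-1) (pa w)) (ξ 1 (-1) w) *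
          k w (ξ (-1) 1 (pa w)) (ξ (-1) 1 w) := by
      refine Finset.prod_congr rfl fun w hw => ?_
      obtain ⟨hwv, hw⟩ := Finset.mem_erase.1 hw
      have hwo := (Finset.mem_erase.1 hw).1
      by_cases hpw : pa w = v
      · have hwu : w ≠ u := by
          rintro rfl
          have := (hpa _ hwo).2
          rw [hpw] at this
          omega
        rw [hpw, ξv, ξv, ξv, ξv, ξnu 1 (-1) 1 w hwu, ξnu (-1) 1 (-1) w hwu]
        ring
      · rw [ξnv 1 1 (-1) _ hpw, ξnv 1 1 (-1) _ hwv, ξnv (-1) 1 (-1) _ hpw,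
          ξnv (-1) 1 (-1) _ hwv]
    rw [Finset.prod_mul_distrib, Finset.prod_mul_distrib] at h1
    rw [hR]
    simp only
    rw [ξnv 1 1 (-1) o hv.symm, ξnv (-1) 1 (-1) o hv.symm]
    linear_combination P (ξ 1 (-1) o) * P (ξ (-1) (-1) o) * h1
  set m : ℝ := ((((G.neighborFinset v).erase u).card : ℕ) : ℝ) with hm
  have hw : ∀ a b, weight G β h {v} (ξ a b) =
      Real.exp (h * (if b = 1 then 1 else -1) +
        β * ((if b = a then 1 else 0) + if b = 1 then m else 0)) := fun a b => by
    have huN : u ∈ G.neighborFinset v := by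
      rw [SimpleGraph.mem_neighborFinset]
      exact hadj.symm
    rw [weight_singleton, spin_eq_ite, ξv, ← Finset.add_sum_erase _ _ huN, ξu]
    congr 3
    have : ∀ w ∈ (G.neighborFinset v).erase u,
        (if b = ξ a b w then (1 : ℝ) else 0) = if b = 1 then 1 else 0 := fun w hw => by
      obtain ⟨h1, h2⟩ := Finset.mem_erase.1 hw
      rw [ξw _ _ _ h1 (by rintro rfl; simp at h2)]
    rw [Finset.sum_congr rfl this, Finset.sum_const, nsmul_eq_mul, ← hm]
    split_ifs <;> simp
  -- The field and the other neighbours of `v` cancel; only the edge from `u` to `v` survives.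
  have hwcross : weight G β h {v} (ξ 1 1) * weight G β h {v} (ξ (-1) (-1)) =
      Real.exp (2 * β) * (weight G β h {v} (ξ 1 (-1)) * weight G β h {v} (ξ (-1) 1)) := by
    rw [hw, hw, hw, hw, ← Real.exp_add, ← Real.exp_add, ← Real.exp_add]
    simp only [if_true, show ((-1 : ℤˣ) = 1) = False by decide,
      show ((1 : ℤˣ) = -1) = False by decide, if_false]
    congr 1
    ring
  have g1 := hν.cyl_mul_weight hN (ξ := ξ 1 1) (ξ' := ξ 1 (-1))
    fun w hw => ξnv _ _ _ w (by simpa using hw)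
  have g2 := hν.cyl_mul_weight hN (ξ := ξ (-1) (-1)) (ξ' := ξ (-1) 1)
    fun w hw => ξnv _ _ _ w (by simpa using hw)
  change C 1 1 * _ = C 1 (-1) * _ at g1
  change C (-1) (-1) * _ = C (-1) 1 * _ at g2
  have w1 := weight_pos G β h {v} (ξ 1 (-1))
  have w2 := weight_pos G β h {v} (ξ (-1) 1)
  have hCcross : C 1 1 * C (-1) (-1) = Real.exp (2 * β) * (C 1 (-1) * C (-1) 1) := by
    refine mul_right_cancel₀ (mul_pos w1 w2).ne' ?_
    linear_combination (C (-1) (-1) * weight G β h {v} (ξ (-1) 1)) * g1 +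
      (C 1 (-1) * weight G β h {v} (ξ 1 1)) * g2 + C 1 (-1) * C (-1) 1 * hwcross
  -- Positivity of the cylinder probabilities allows the common factor to be cancelled.
  have hne : R 1 1 * R (-1) (-1) ≠ 0 := by
    have r1 := Cpos 1 1
    have r2 := Cpos (-1) (-1)
    rw [CR] at r1 r2
    exact mul_ne_zero (right_ne_zero_of_mul r1.ne') (right_ne_zero_of_mul r2.ne')
  refine mul_right_cancel₀ hne ?_
  rw [CR, CR, CR, CR] at hCcross
  linear_combination hCcross - Real.exp (2 * β) * (k v 1 (-1) * k v (-1) 1) * hRcross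

end

/-! ### Reversibility, independence of the root, and uniqueness. -/

section

theorem jointTable_comm (q x : ℝ) (a b : ℤˣ) : jointTable q x a b = jointTable q x b a := by
  unfold jointTable
  by_cases h : a = b
  · rw [h]
  · rw [if_neg h, if_neg (Ne.symm h)]

theorem HasOddsRatio.marginal_pos {q x E : ℝ} (hx : HasOddsRatio q x E) (a : ℤˣ) :
    0 < marginal q a := by
  unfold marginal
  split_ifs
  · exact hx.pos.trans hx.lt
  · exact hx.pos.trans hx.lt'

theorem HasOddsRatio.jointTable_pos {q x E : ℝ} (hx : HasOddsRatio q x E) (a b : ℤˣ) :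
    0 < jointTable q x a b := by
  unfold jointTable marginal
  split_ifs
  · linarith [hx.lt]
  · linarith [hx.lt']
  · exact hx.pos

/-- The density of `jointTable q x` with respect to the product of its marginals, as a function on
unordered pairs. -/
noncomputable def edgeDensity (q x : ℝ) : Sym2 ℤˣ → ℝ :=
  Sym2.lift ⟨fun a b => jointTable q x a b / (marginal q a * marginal q b), fun a b => by
    simp only
    rw [jointTable_comm, mul_comm (marginal q a)]⟩

theorem HasOddsRatio.edgeDensity_pos {q x E : ℝ} (hx : HasOddsRatio q x E) (e : Sym2 ℤˣ) :
    0 < edgeDensity q x e := by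
  induction e with
  | _ a b =>
    exact div_pos (hx.jointTable_pos a b) (mul_pos (hx.marginal_pos a) (hx.marginal_pos b))

variable {V : Type*} [DecidableEq V]

/-- The cylinder probabilities of the reversible chain do not refer to the root. -/
theorem HasChainLaw.eq_prod_edges {G : SimpleGraph V} {ν : Measure (Config V)} {o : V} {pa : V → V}
    (hpa : IsParent G o pa) {q x E : ℝ} (hx : HasOddsRatio q x E)
    (hν : HasChainLaw ν o pa (marginal q) fun _ => transition q x) {Λ : Finset V}
    (hΛ : IsClosedUnder o pa Λ) (ξ : Config V) :
    ν.real (cyl Λ ξ) = (∏ v ∈ Λ, marginal q (ξ v)) *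
      ∏ e ∈ parentEdges o pa Λ, edgeDensity q x (e.map ξ) := by
  -- Each transition weight is the marginal weight of the child times the symmetric edge density.
  rw [hν Λ hΛ, hpa.prod_parentEdges, ← Finset.mul_prod_erase _ _ hΛ.1, mul_assoc,
    ← Finset.prod_mul_distrib]
  congr 1
  refine Finset.prod_congr rfl fun v _ => ?_
  have h1 := (hx.marginal_pos (ξ v)).ne'
  have h2 := (hx.marginal_pos (ξ (pa v))).ne'
  rw [Sym2.map_mk, edgeDensity, Sym2.lift_mk]
  simp only [transition]
  field_simp

/-- Large balls about `o` are subtrees for both roots, and on them both laws equal the same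
root-free product. -/
theorem HasChainLaw.measure_unique {G : SimpleGraph V} [G.LocallyFinite] (hG : G.IsTree)
    {ν ν' : Measure (Config V)} [IsProbabilityMeasure ν] [IsProbabilityMeasure ν'] {o o' : V}
    {pa pa' : V → V} (hpa : IsParent G o pa) (hpa' : IsParent G o' pa') {q x E : ℝ}
    (hx : HasOddsRatio q x E) (hν : HasChainLaw ν o pa (marginal q) fun _ => transition q x)
    (hν' : HasChainLaw ν' o' pa' (marginal q) fun _ => transition q x) : ν = ν' := by
  refine ext_of_cyl fun S => ?_
  obtain ⟨n, hn, hS⟩ := exists_subset_finBall hG.connected o S (G.dist o o')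
  refine ⟨_, hS, fun ξ => ?_⟩
  have h1 := hpa.isClosedUnder_finBall hG.connected n
  have h2 := hpa'.isClosedUnder_finBall_of_dist_le hG hn
  rw [← ENNReal.toReal_eq_toReal_iff' (measure_ne_top _ _) (measure_ne_top _ _)]
  change ν.real _ = ν'.real _
  rw [hν.eq_prod_edges hpa hx h1, hν'.eq_prod_edges hpa' hx h2,
    parentEdges_eq_parentEdges hG hpa hpa' h1 h2]

theorem pmf_toReal_add (p : PMF ℤˣ) : (p 1).toReal + (p (-1)).toReal = 1 := by
  have h := p.tsum_coe
  rw [tsum_fintype] at h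
  have h2 : (Finset.univ : Finset ℤˣ) = {1, -1} := rfl
  rw [h2, Finset.sum_pair (by decide)] at h
  rw [← ENNReal.toReal_add (p.apply_ne_top _) (p.apply_ne_top _), h, ENNReal.toReal_one]

/-- A translation-invariant Ising measure of magnetization `2 q - 1` is the reversible chain with
single-site law `marginal q`. -/
theorem exists_hasChainLaw {G : SimpleGraph V} [G.LocallyFinite] (hG : G.Connected) {β h q x : ℝ}
    (hx : HasOddsRatio q x (Real.exp (2 * β))) {ν : Measure (Config V)}
    (hν : ν ∈ invariantIsing G β h) (hmag : ∀ v, magnetization ν v = 2 * q - 1) :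
    ∃ o pa, IsParent G o pa ∧ HasChainLaw ν o pa (marginal q) fun _ => transition q x := by
  obtain ⟨hgibbs, ⟨o, pa, p, K, hpa, hK⟩, -⟩ := hν
  have := hgibbs.1
  have hpa : IsParent G o pa := hpa
  have hc : HasChainLaw ν o pa (fun a => (p a).toReal) fun v a b => (K v a b).toReal := by
    intro Λ hΛ ξ
    rw [measureReal_def]
    change (ν {σ | ∀ v ∈ Λ, σ v = ξ v}).toReal = _
    rw [hK Λ hΛ.1 hΛ.2 ξ, ENNReal.toReal_mul, ENNReal.toReal_prod]
  have hone : ∀ v, ν.real {σ | σ v = 1} = q := fun v => by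
    have := hmag v
    rw [magnetization_eq] at this
    linarith
  have hmarg : ∀ v a, ν.real {σ | σ v = a} = marginal q a := fun v a => by
    rcases Int.units_eq_one_or a with rfl | rfl
    · rw [hone, marginal, if_pos rfl]
    · rw [marginal, if_neg (by decide), ← hone v, ← real_one_add_real_neg_one ν v]
      ring
  have hker : ∀ v, v ≠ o → (fun a b => (K v a b).toReal) = transition q x := by
    intro v hv
    refine eq_transition hx (Real.exp_pos _) (fun _ _ => ENNReal.toReal_nonneg)
      (fun a => pmf_toReal_add _) ?_ (hgibbs.odds_ratio hG hpa hc hv)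
    -- Stationarity: `pa v` and `v` have the same law, so conditioning on the spin of `pa v` gives
    -- the invariance equation.
    have j1 := hc.joint hG hpa hv 1 1
    have j2 := hc.joint hG hpa hv (-1) 1
    rw [hmarg] at j1 j2
    rw [show marginal q 1 = q from if_pos rfl] at j1
    rw [show marginal q (-1) = 1 - q from if_neg (by decide)] at j2
    rw [← j1, ← j2, ← hone v]
    have hm := measurableSet_spin_eq (pa v) (1 : ℤˣ)
    rw [← measureReal_inter_add_sdiff (s := {σ : Config V | σ v = 1}) hm]
    congr 2
    · exact Set.inter_comm _ _
    · ext σ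
      rcases Int.units_eq_one_or (σ (pa v)) with h | h <;> simp [h]
  refine ⟨o, pa, hpa, fun Λ hΛ ξ => ?_⟩
  rw [hc Λ hΛ, ← hmarg o, hc.root]
  congr 1
  refine Finset.prod_congr rfl fun v hv => ?_
  exact congrFun (congrFun (hker v (Finset.ne_of_mem_erase hv)) _) _

end

/-! ### Construction of the broadcast process. -/

section

theorem exists_pmf {f : ℤˣ → ℝ} (hf : ∀ a, 0 ≤ f a) (hsum : f 1 + f (-1) = 1) :
    ∃ p : PMF ℤˣ, ∀ a, (p a).toReal = f a := by
  refine ⟨PMF.ofFintype (fun a => ENNReal.ofReal (f a)) ?_, fun a => ?_⟩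
  · have h2 : (Finset.univ : Finset ℤˣ) = {1, -1} := rfl
    rw [h2, Finset.sum_pair (by decide), ← ENNReal.ofReal_add (hf _) (hf _), hsum,
      ENNReal.ofReal_one]
  · rw [PMF.ofFintype_apply, ENNReal.toReal_ofReal (hf a)]

variable {V : Type*}

/-- The spins after `n` steps of the recursion that computes the spin of `v` from that of `pa v`
by means of the innovations `ω`. -/
def broadcastStep (pa : V → V) : ℕ → (V × ℤˣ → ℤˣ) → Config V
  | 0, _ => 1
  | n + 1, ω => fun v => ω (v, broadcastStep pa n ω (pa v))

theorem measurable_broadcastStep (pa : V → V) (n : ℕ) (v : V) :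
    Measurable fun ω => broadcastStep pa n ω v := by
  induction n generalizing v with
  | zero => exact measurable_const
  | succ n ih =>
    have h : (fun ω => broadcastStep pa (n + 1) ω v) = fun ω : V × ℤˣ → ℤˣ =>
        if broadcastStep pa n ω (pa v) = 1 then ω (v, 1) else ω (v, -1) := by
      funext ω
      rw [broadcastStep]
      rcases Int.units_eq_one_or (broadcastStep pa n ω (pa v)) with h | h <;> simp [h]
    rw [h]
    have hm : MeasurableSet {ω : V × ℤˣ → ℤˣ | broadcastStep pa n ω (pa v) = 1} := by
      have h' : {ω : V × ℤˣ → ℤˣ | broadcastStep pa n ω (pa v) = 1} =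
          (fun ω => broadcastStep pa n ω (pa v)) ⁻¹' {1} := by
        ext ω
        simp
      rw [h']
      exact ih (pa v) (measurableSet_spins _)
    exact Measurable.ite hm (measurable_pi_apply _) (measurable_pi_apply _)

variable [DecidableEq V]

/-- Existence of the broadcast process with given initial law and transition matrices. -/
theorem exists_broadcast {G : SimpleGraph V} (hG : G.Connected) {o : V} {pa : V → V}
    (hpa : IsParent G o pa) (hpao : pa o = o) (p : PMF ℤˣ) (K : V → ℤˣ → PMF ℤˣ) :
    ∃ ν : Measure (Config V), IsProbabilityMeasure ν ∧
      ∀ Λ : Finset V, IsClosedUnder o pa Λ → ∀ ξ : Config V,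
        ν (cyl Λ ξ) = p (ξ o) * ∏ v ∈ Λ.erase o, K v (ξ (pa v)) (ξ v) := by
  set Q : V × ℤˣ → PMF ℤˣ := fun i => if i.1 = o then p else K i.1 i.2 with hQ
  -- The extra step samples the root itself; the initial value `1` acts as its fictitious parent
  -- spin.
  set F : (V × ℤˣ → ℤˣ) → Config V := fun ω v => broadcastStep pa (G.dist o v + 1) ω v with hF
  have hFm : Measurable F := measurable_pi_iff.2 fun v => measurable_broadcastStep pa _ v
  have hFo : ∀ ω, F ω o = ω (o, 1) := fun ω => by
    simp only [hF, SimpleGraph.dist_self, broadcastStep, Pi.one_apply]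
  have hFv : ∀ ω v, v ≠ o → F ω v = ω (v, F ω (pa v)) := fun ω v hv => by
    simp only [hF]
    rw [(hpa v hv).2, broadcastStep]
  set μ : Measure (V × ℤˣ → ℤˣ) := Measure.infinitePi fun i => (Q i).toMeasure
  refine ⟨μ.map F, Measure.isProbabilityMeasure_map hFm.aemeasurable, fun Λ hΛ ξ => ?_⟩
  set c : V → ℤˣ := fun v => if v = o then 1 else ξ (pa v) with hc
  -- Along `ξ` the vertex `v` reads only the innovation `(v, c v)`. These coordinates are distinct,
  -- so the product measure factorizes.
  have hpre : F ⁻¹' cyl Λ ξ =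
      Set.pi (Λ.image fun v => (v, c v) : Finset (V × ℤˣ)) fun i => {ξ i.1} := by
    ext ω
    simp only [Set.mem_preimage, Set.mem_pi, Finset.coe_image, Set.mem_image, Finset.mem_coe,
      forall_exists_index, and_imp, forall_apply_eq_imp_iff₂, Set.mem_singleton_iff]
    constructor
    · intro h v hv
      by_cases hvo : v = o
      · rw [hc]
        simp only [hvo, if_true]
        rw [← hFo ω, h o hΛ.1]
      · rw [hc]
        simp only [hvo, if_false]
        rw [← h v hv, hFv ω v hvo, h _ (hΛ.2 v hv hvo)]
    · intro h
      have key : ∀ n, ∀ v ∈ Λ, G.dist o v = n → F ω v = ξ v := by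
        intro n
        induction n with
        | zero =>
          intro v hv hd
          obtain rfl := (hG.dist_eq_zero_iff).1 hd
          rw [hFo, ← h _ hv, hc]
          simp
        | succ n ih =>
          intro v hv hd
          have hvo : v ≠ o := by
            rintro rfl
            simp at hd
          have := (hpa v hvo).2
          rw [hFv ω v hvo, ih (pa v) (hΛ.2 v hv hvo) (by omega), ← h v hv, hc]
          simp [hvo]
      exact fun v hv => key _ v hv rfl
  rw [Measure.map_apply hFm (measurableSet_cyl _ _), hpre,
    Measure.infinitePi_pi _ fun i _ => measurableSet_spins _,
    Finset.prod_image fun v _ w _ h => (Prod.mk.inj h).1, ← Finset.mul_prod_erase _ _ hΛ.1]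
  have hs : ∀ v, (Q (v, c v)).toMeasure {ξ v} = Q (v, c v) (ξ v) := fun v =>
    PMF.toMeasure_apply_singleton _ _ (measurableSet_spins _)
  simp only [hs]
  congr 1
  · simp [hQ]
  · refine Finset.prod_congr rfl fun v hv => ?_
    simp [hQ, hc, Finset.ne_of_mem_erase hv]

/-- The marginals of the reversible chain are constant. -/
theorem HasChainLaw.real_spin_eq {G : SimpleGraph V} [G.LocallyFinite] (hG : G.Connected)
    {ν : Measure (Config V)} [IsProbabilityMeasure ν] {o : V} {pa : V → V} (hpa : IsParent G o pa)
    {q x E : ℝ} (hx : HasOddsRatio q x E)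
    (hν : HasChainLaw ν o pa (marginal q) fun _ => transition q x) (v : V) (b : ℤˣ) :
    ν.real {σ | σ v = b} = marginal q b := by
  obtain ⟨n, hn⟩ : ∃ n, G.dist o v = n := ⟨_, rfl⟩
  induction n generalizing v b with
  | zero =>
    obtain rfl := (hG.dist_eq_zero_iff).1 hn
    exact hν.root b
  | succ n ih =>
    have hvo : v ≠ o := by
      rintro rfl
      simp at hn
    have hd := (hpa v hvo).2
    have ih' := fun a => ih (pa v) a (by omega)
    have j1 := hν.joint hG hpa hvo 1 b
    have j2 := hν.joint hG hpa hvo (-1) b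
    rw [ih'] at j1 j2
    have hm := measurableSet_spin_eq (pa v) (1 : ℤˣ)
    rw [← measureReal_inter_add_sdiff (s := {σ : Config V | σ v = b}) hm]
    have h1 : {σ : Config V | σ v = b} ∩ {σ | σ (pa v) = 1}
        = {σ | σ (pa v) = 1} ∩ {σ | σ v = b} := Set.inter_comm _ _
    have h2 : {σ : Config V | σ v = b} \ {σ | σ (pa v) = 1}
        = {σ | σ (pa v) = -1} ∩ {σ | σ v = b} := by
      ext σ
      rcases Int.units_eq_one_or (σ (pa v)) with h | h <;> simp [h]
    rw [h1, h2, j1, j2, transition, transition, mul_div_cancel₀ _ (hx.marginal_pos 1).ne',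
      mul_div_cancel₀ _ (hx.marginal_pos (-1)).ne']
    rcases Int.units_eq_one_or b with rfl | rfl <;>
      simp [jointTable, marginal]

end

/-! ### A cylinder criterion for the DLR equations, and exponential forms. -/

section

theorem measurable_spin {V : Type*} (v : V) : Measurable fun σ : Config V => spin σ v :=
  (Measurable.of_discrete (f := fun a : ℤˣ => ((a : ℤ) : ℝ))).comp (measurable_pi_apply v)

variable {V : Type*} [DecidableEq V]

theorem measurable_glue (Λ : Finset V) (τ : Λ → ℤˣ) : Measurable (glue Λ τ) := by
  refine measurable_pi_iff.2 fun v => ?_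
  by_cases hv : v ∈ Λ
  · simp only [glue_of_mem _ _ hv]
    exact measurable_const
  · simp only [glue_of_notMem _ _ hv]
    exact measurable_pi_apply v

theorem measurable_weight (G : SimpleGraph V) [G.LocallyFinite] (β h : ℝ) (Λ : Finset V) :
    Measurable (weight G β h Λ) := by
  have h1 : Measurable fun σ : Config V => (monoEdges G Λ σ : ℝ) := by
    simp only [monoEdges, Finset.card_filter, Nat.cast_sum]
    refine Finset.measurable_sum _ fun e _ => ?_
    induction e with
    | _ u v =>
      simp only [Sym2.map_mk, Sym2.mk_isDiag_iff]
      have : (fun σ : Config V => (((if σ u = σ v then 1 else 0 : ℕ) : ℕ) : ℝ))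
          = fun σ => (1 + spin σ u * spin σ v) / 2 := by
        funext σ
        rw [spin_eq_ite, spin_eq_ite]
        rcases Int.units_eq_one_or (σ u) with h | h <;>
          rcases Int.units_eq_one_or (σ v) with h' | h' <;> simp [h, h']
      rw [this]
      exact (((measurable_spin u).mul (measurable_spin v)).const_add 1).div_const 2
  exact Real.measurable_exp.comp
    (((Finset.measurable_sum _ fun v _ => measurable_spin v).const_mul h).add (h1.const_mul β))

theorem measurable_finiteVolume (G : SimpleGraph V) [G.LocallyFinite] (β h : ℝ) (Λ : Finset V) :
    Measurable (finiteVolume G β h Λ) := by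
  refine Measure.measurable_of_measurable_coe _ fun A hA => ?_
  simp only [finiteVolume_apply G β h Λ _ hA]
  refine Finset.measurable_sum _ fun τ _ => ?_
  have hw : ∀ τ : Λ → ℤˣ, Measurable fun ζ => weight G β h Λ (glue Λ τ ζ) := fun τ =>
    (measurable_weight G β h Λ).comp (measurable_glue Λ τ)
  exact ((hw τ).div (Finset.measurable_sum _ fun τ _ => hw τ)).ennreal_ofReal.mul
    ((measurable_one.indicator hA).comp (measurable_glue Λ τ))

/-- The DLR equations follow if, for large finite sets, the ratio of the probabilities of cylinders
that differ only in `Λ` is the ratio of the Ising weights. -/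
theorem isGibbs_of_cyl_mul_weight {G : SimpleGraph V} [G.LocallyFinite] {β h : ℝ}
    {ν : Measure (Config V)} [IsProbabilityMeasure ν]
    (H : ∀ Λ S : Finset V, ∃ T, S ⊆ T ∧ ContainsNbhd G Λ T ∧
      ∀ ξ ξ' : Config V, (∀ v, v ∉ Λ → ξ v = ξ' v) →
        ν.real (cyl T ξ) * weight G β h Λ ξ' = ν.real (cyl T ξ') * weight G β h Λ ξ) :
    IsGibbs G β h ν := by
  refine ⟨inferInstance, fun Λ => ?_⟩
  have hm := measurable_finiteVolume G β h Λ
  suffices hb : ν = ν.bind (finiteVolume G β h Λ) by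
    intro A hA
    conv_lhs => rw [hb]
    rw [Measure.bind_apply hA hm.aemeasurable]
  refine ext_of_cyl fun S => ?_
  obtain ⟨T, hST, hT, hcross⟩ := H Λ S
  refine ⟨T, hST, fun ξ => ?_⟩
  rw [Measure.bind_apply (measurableSet_cyl _ _) hm.aemeasurable, lintegral_finiteVolume_cyl β h hT]
  have hw := weight_pos G β h Λ ξ
  have hZ := partitionFn_pos G β h Λ ξ
  -- Summing the ratio identity over all fillings of `Λ` produces the partition function.
  have h1 : ν.real (cyl (T \ Λ) ξ) * weight G β h Λ ξ =
      partitionFn G β h Λ ξ * ν.real (cyl T ξ) := by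
    rw [real_eq_sum_cyl ν Λ, partitionFn, Finset.sum_mul, Finset.sum_mul]
    refine Finset.sum_congr rfl fun τ _ => ?_
    have h2 : cyl (T \ Λ) ξ ∩ cyl Λ (glue Λ τ 1) = cyl T (glue Λ τ ξ) := by
      ext σ
      constructor
      · rintro ⟨ha, hb⟩ v hv
        by_cases hvΛ : v ∈ Λ
        · rw [hb v hvΛ, glue_of_mem _ _ hvΛ, glue_of_mem _ _ hvΛ]
        · rw [ha v (Finset.mem_sdiff.2 ⟨hv, hvΛ⟩), glue_of_notMem _ _ hvΛ]
      · intro h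
        refine ⟨fun v hv => ?_, fun v hv => ?_⟩
        · obtain ⟨hv, hvΛ⟩ := Finset.mem_sdiff.1 hv
          rw [h v hv, glue_of_notMem _ _ hvΛ]
        · rw [h v (hT v hv).1, glue_of_mem _ _ hv, glue_of_mem _ _ hv]
    rw [h2, hcross _ ξ fun v hv => glue_of_notMem _ _ hv, mul_comm]
  rw [← ENNReal.toReal_eq_toReal_iff' (measure_ne_top _ _)
    (ENNReal.mul_ne_top ENNReal.ofReal_ne_top (measure_ne_top _ _)), ENNReal.toReal_mul,
    ENNReal.toReal_ofReal (div_pos hw hZ).le]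
  change ν.real _ = _ * ν.real _
  field_simp
  linear_combination -h1

theorem exists_marginal_eq_exp {q : ℝ} (hq : 0 < q) (hq' : 0 < 1 - q) :
    ∃ α η : ℝ, ∀ a : ℤˣ, marginal q a = Real.exp (α + η * ((a : ℤ) : ℝ)) := by
  refine ⟨(Real.log q + Real.log (1 - q)) / 2, (Real.log q - Real.log (1 - q)) / 2, fun a => ?_⟩
  rcases Int.units_eq_one_or a with rfl | rfl
  · rw [marginal, if_pos rfl, ← Real.exp_log hq]
    simp only [Real.log_exp, Units.val_one, Int.cast_one]
    congr 1
    ring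
  · rw [marginal, if_neg (by decide), ← Real.exp_log hq']
    simp only [Real.log_exp, Units.val_neg, Units.val_one, Int.cast_neg, Int.cast_one]
    congr 1
    ring

/-- A symmetric function on two spins has three values. The mixed value gives `c`, the asymmetry of
the equal pairs gives `κ`, and the odds ratio forces the coefficient `β`. -/
theorem HasOddsRatio.exists_edgeDensity_eq_exp {q x β : ℝ}
    (hx : HasOddsRatio q x (Real.exp (2 * β))) :
    ∃ c κ : ℝ, ∀ a b : ℤˣ, edgeDensity q x s(a, b) =
      Real.exp (c + β * (if a = b then 1 else 0) + κ * (((a : ℤ) : ℝ) + ((b : ℤ) : ℝ))) := by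
  set f := fun a b => Real.log (edgeDensity q x s(a, b)) with hf
  have hq := hx.marginal_pos 1
  have hq' := hx.marginal_pos (-1)
  have hprod : edgeDensity q x s(1, 1) * edgeDensity q x s(-1, -1) =
      Real.exp (2 * β) * edgeDensity q x s(1, -1) ^ 2 := by
    have h := hx.eq
    simp only [edgeDensity, Sym2.lift_mk, jointTable, marginal, if_true,
      show ((-1 : ℤˣ) = 1) = False by decide, show ((1 : ℤˣ) = -1) = False by decide,
      if_false] at hq hq' ⊢
    field_simp
    linear_combination h
  have hlog := congrArg Real.log hprod
  rw [Real.log_mul (hx.edgeDensity_pos _).ne' (hx.edgeDensity_pos _).ne',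
    Real.log_mul (Real.exp_pos _).ne' (pow_pos (hx.edgeDensity_pos _) 2).ne', Real.log_exp,
    Real.log_pow] at hlog
  push_cast at hlog
  refine ⟨f 1 (-1), (f 1 1 - f (-1) (-1)) / 4, fun a b => ?_⟩
  rw [← Real.exp_log (hx.edgeDensity_pos s(a, b))]
  congr 1
  rcases Int.units_eq_one_or a with rfl | rfl <;> rcases Int.units_eq_one_or b with rfl | rfl <;>
    simp only [hf, if_true, show ((-1 : ℤˣ) = 1) = False by decide,
      show ((1 : ℤˣ) = -1) = False by decide, if_false, Units.val_neg, Units.val_one,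
      Int.cast_neg, Int.cast_one]
  · linear_combination hlog / 2
  · ring
  · rw [Sym2.eq_swap]
    ring
  · linear_combination hlog / 2

end

/-! ### The reversible chain is an Ising measure. -/

section

variable {V : Type*} [DecidableEq V]

/-- The reversible chain on the regular tree satisfies the DLR equations for some field. -/
theorem HasChainLaw.exists_isGibbs {G : SimpleGraph V} [G.LocallyFinite] (hG : G.IsTree) {d : ℕ}
    (hreg : G.IsRegularOfDegree d) {β : ℝ} {ν : Measure (Config V)} [IsProbabilityMeasure ν]
    {o : V} {pa : V → V} (hpa : IsParent G o pa) {q x : ℝ}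
    (hx : HasOddsRatio q x (Real.exp (2 * β)))
    (hν : HasChainLaw ν o pa (marginal q) fun _ => transition q x) :
    ∃ h, IsGibbs G β h ν := by
  obtain ⟨α, η, hmarg⟩ := exists_marginal_eq_exp (hx.pos.trans hx.lt) (hx.pos.trans hx.lt')
  obtain ⟨c, κ, hedge⟩ := hx.exists_edgeDensity_eq_exp
  -- The marginal contributes `η` to the field at a vertex, and each of its `d` edges contributes
  -- `κ`.
  refine ⟨η + d * κ, isGibbs_of_cyl_mul_weight fun Λ S => ?_⟩
  obtain ⟨n, -, hn⟩ := exists_subset_finBall hG.connected o (S ∪ Λ) 0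
  have hT : ContainsNbhd G Λ (finBall G o (n + 1)) :=
    containsNbhd_finBall (Finset.subset_union_right.trans hn)
  have hST : S ⊆ finBall G o (n + 1) :=
    (Finset.subset_union_left.trans hn).trans Finset.subset_union_left
  refine ⟨_, hST, hT, ?_⟩
  have hTc := hpa.isClosedUnder_finBall hG.connected (n + 1)
  set T := finBall G o (n + 1)
  set E := parentEdges o pa T with hE
  have hmemE : ∀ {u v}, s(u, v) ∈ E ↔ G.Adj u v ∧ u ∈ T ∧ v ∈ T := hpa.mk_mem_parentEdges hG hTc
  have hΛT : Λ ⊆ T := fun v hv => (hT v hv).1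
  have htouch : touchingEdges G Λ ⊆ E := by
    intro e he
    induction e with
    | _ u v =>
      obtain ⟨hadj, hu | hv⟩ := mk_mem_touchingEdges.1 he
      · exact hmemE.2 ⟨hadj, (hT u hu).1, (hT u hu).2 v hadj⟩
      · exact hmemE.2 ⟨hadj, (hT v hv).2 u hadj.symm, (hT v hv).1⟩
  set mono : Config V → Sym2 V → ℝ := fun σ e => if (e.map σ).IsDiag then 1 else 0 with hmono
  -- Vertices at the rim of `T` may lack edges in `E`; those in `Λ` have all `d`, since `T` contains
  -- their neighbours.
  set deg : V → ℝ := fun v => ((E.filter fun e => v ∈ e).card : ℕ) with hdeg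
  have hdegΛ : ∀ v ∈ Λ, deg v = d := by
    intro v hv
    have : (E.filter fun e => v ∈ e) = G.incidenceFinset v := by
      ext e
      rw [Finset.mem_filter, SimpleGraph.mem_incidenceFinset]
      constructor
      · rintro ⟨he, hve⟩
        induction e with
        | _ a b => exact ⟨(hmemE.1 he).1, hve⟩
      · intro he
        exact ⟨htouch (Finset.mem_biUnion.2 ⟨v, hv, (G.mem_incidenceFinset v e).2 he⟩), he.2⟩
    simp only [hdeg]
    rw [this, SimpleGraph.card_incidenceFinset_eq_degree, hreg v]
  have hedge' : ∀ σ : Config V, ∀ e ∈ E, edgeDensity q x (e.map σ) =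
      Real.exp (c + β * mono σ e + κ * ∑ v ∈ T, if v ∈ e then spin σ v else 0) := by
    intro σ e he
    induction e with
    | _ u v =>
      obtain ⟨hadj, hu, hv⟩ := hmemE.1 he
      have h1 : (T.filter fun w => w ∈ s(u, v)) = {u, v} := by
        ext w
        simp only [Finset.mem_filter, Sym2.mem_iff, Finset.mem_insert, Finset.mem_singleton]
        constructor
        · exact fun h => h.2
        · rintro (rfl | rfl)
          · exact ⟨hu, Or.inl rfl⟩
          · exact ⟨hv, Or.inr rfl⟩
      rw [← Finset.sum_filter, h1, Finset.sum_pair hadj.ne, Sym2.map_mk, hedge]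
      simp only [hmono, Sym2.map_mk, Sym2.mk_isDiag_iff]
      rfl
  -- Everything in the exponent that does not involve the spins in `Λ`; it cancels in the ratio.
  set rest : Config V → ℝ := fun σ => T.card * α + E.card * c +
    ∑ v ∈ T \ Λ, (η + deg v * κ) * spin σ v + β * ∑ e ∈ E \ touchingEdges G Λ, mono σ e with hrest
  have hF : ∀ σ : Config V, ν.real (cyl T σ) =
      weight G β (η + d * κ) Λ σ * Real.exp (rest σ) := by
    intro σ
    rw [hν.eq_prod_edges hpa hx hTc, Finset.prod_congr rfl (hedge' σ),
      Finset.prod_congr rfl fun v _ => hmarg (σ v), ← Real.exp_sum, ← Real.exp_sum,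
      ← Real.exp_add, weight, ← Real.exp_add]
    congr 1
    have h1 : (monoEdges G Λ σ : ℝ) = ∑ e ∈ touchingEdges G Λ, mono σ e := by
      rw [monoEdges, Finset.card_filter]
      push_cast
      rfl
    have h2 : ∑ e ∈ E, ∑ v ∈ T, (if v ∈ e then spin σ v else 0) = ∑ v ∈ T, deg v * spin σ v := by
      rw [Finset.sum_comm]
      refine Finset.sum_congr rfl fun v _ => ?_
      rw [← Finset.sum_filter, Finset.sum_const, nsmul_eq_mul]
    have h3 : ∑ v ∈ Λ, (η + deg v * κ) * spin σ v = (η + d * κ) * ∑ v ∈ Λ, spin σ v := by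
      rw [Finset.mul_sum]
      exact Finset.sum_congr rfl fun v hv => by rw [hdegΛ v hv]
    have h4 := Finset.sum_sdiff (f := fun v => (η + deg v * κ) * spin σ v) hΛT
    have h5 := Finset.sum_sdiff (f := mono σ) htouch
    have h6 : ∑ v ∈ T, (η + deg v * κ) * spin σ v =
        η * ∑ v ∈ T, spin σ v + κ * ∑ v ∈ T, deg v * spin σ v := by
      rw [Finset.mul_sum, Finset.mul_sum, ← Finset.sum_add_distrib]
      exact Finset.sum_congr rfl fun v _ => by ring
    have h7 : ∑ v ∈ T, (α + η * (((σ v : ℤˣ) : ℤ) : ℝ)) =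
        T.card * α + η * ∑ v ∈ T, spin σ v := by
      rw [Finset.sum_add_distrib, Finset.sum_const, nsmul_eq_mul, Finset.mul_sum]
      rfl
    rw [h7, Finset.sum_add_distrib, Finset.sum_add_distrib, Finset.sum_const, nsmul_eq_mul,
      ← Finset.mul_sum, ← Finset.mul_sum, h2, h1, hrest]
    simp only
    linear_combination h3 + β * (-h5) - h4 - h6
  intro ξ ξ' hξ
  have hr : rest ξ = rest ξ' := by
    have h1 : ∀ v ∈ T \ Λ, (η + deg v * κ) * spin ξ v = (η + deg v * κ) * spin ξ' v :=
      fun v hv => by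
        simp only [spin]
        rw [hξ v (Finset.mem_sdiff.1 hv).2]
    have h2 : ∀ e ∈ E \ touchingEdges G Λ, mono ξ e = mono ξ' e := by
      intro e he
      induction e with
      | _ u v =>
        obtain ⟨he, he'⟩ := Finset.mem_sdiff.1 he
        rw [mk_mem_touchingEdges] at he'
        have hadj := (hmemE.1 he).1
        have hmap : s(u, v).map ξ = s(u, v).map ξ' := by
          rw [Sym2.map_mk, Sym2.map_mk, hξ u fun h => he' ⟨hadj, Or.inl h⟩,
            hξ v fun h => he' ⟨hadj, Or.inr h⟩]
        exact congrArg (fun e : Sym2 ℤˣ => if e.IsDiag then (1 : ℝ) else 0) hmap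
    simp only [hrest]
    rw [Finset.sum_congr rfl h1, Finset.sum_congr rfl h2]
  rw [hF, hF, hr]
  ring

theorem exists_isBroadcast_hasChainLaw {G : SimpleGraph V} (hG : G.Connected) {q x E : ℝ}
    (hx : HasOddsRatio q x E) : ∃ (ν : Measure (Config V)) (o : V) (pa : V → V),
      IsProbabilityMeasure ν ∧ IsBroadcast G ν ∧ IsParent G o pa ∧
        HasChainLaw ν o pa (marginal q) fun _ => transition q x := by
  obtain ⟨o⟩ := hG.nonempty
  obtain ⟨pa, hpa, hpao⟩ := exists_isParent hG o
  obtain ⟨p, hp⟩ := exists_pmf (fun a => (hx.marginal_pos a).le)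
    (by simp [marginal] : marginal q 1 + marginal q (-1) = 1)
  have hK : ∀ a, ∃ K : PMF ℤˣ, ∀ b, (K b).toReal = transition q x a b := fun a =>
    exists_pmf (fun b => (div_pos (hx.jointTable_pos a b) (hx.marginal_pos a)).le) (by
      have := (hx.marginal_pos a).ne'
      rw [transition, transition, ← add_div, div_eq_one_iff_eq this]
      rcases Int.units_eq_one_or a with rfl | rfl <;> simp [jointTable, marginal])
  choose K hK using hK
  obtain ⟨ν, hν, hcyl⟩ := exists_broadcast hG hpa hpao p fun _ => K
  refine ⟨ν, o, pa, hν, ⟨o, pa, p, fun _ => K, hpa, fun Λ ho hΛ ξ => hcyl Λ ⟨ho, hΛ⟩ ξ⟩, hpa,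
    fun Λ hΛ ξ => ?_⟩
  rw [measureReal_def, hcyl Λ hΛ, ENNReal.toReal_mul, ENNReal.toReal_prod, hp]
  simp only [hK]

end

end TreeIsing

/-! ### Existence and uniqueness combined. -/

theorem mainTheorem9 {V : Type*} [DecidableEq V] (G : SimpleGraph V) [G.LocallyFinite]
    (hG : G.IsTree) (d : ℕ) (hd : 3 ≤ d) (hreg : G.IsRegularOfDegree d)
    (β : ℝ) (hβ : 0 ≤ β) (η : ℝ) (hη : η ∈ Set.Ioo (-1 : ℝ) 1) :
    ∃ (h : ℝ) (ν : Measure (TreeIsing.Config V)),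
      (ν ∈ TreeIsing.invariantIsing G β h ∧ ∀ v : V, TreeIsing.magnetization ν v = η) ∧
      ∀ (h' : ℝ) (ν' : Measure (TreeIsing.Config V)),
        (ν' ∈ TreeIsing.invariantIsing G β h' ∧ ∀ v : V, TreeIsing.magnetization ν' v = η) →
          h' = h ∧ ν' = ν := by
  obtain ⟨q, rfl⟩ : ∃ q, η = 2 * q - 1 := ⟨(1 + η) / 2, by ring⟩
  obtain ⟨hη1, hη2⟩ := hη
  obtain ⟨x, hx⟩ := TreeIsing.exists_hasOddsRatio (q := q) (by linarith) (by linarith)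
    (Real.exp_pos (2 * β))
  obtain ⟨ν, o, pa, hprob, hbc, hpa, hc⟩ :=
    TreeIsing.exists_isBroadcast_hasChainLaw hG.connected hx
  obtain ⟨h, hgibbs⟩ := hc.exists_isGibbs hG hreg hpa hx
  have hmag : ∀ v, TreeIsing.magnetization ν v = 2 * q - 1 := fun v => by
    rw [TreeIsing.magnetization_eq, hc.real_spin_eq hG.connected hpa hx]
    simp [TreeIsing.marginal]
  refine ⟨h, ν, ⟨⟨hgibbs, hbc, fun v w => (hmag v).trans (hmag w).symm⟩, hmag⟩, ?_⟩
  rintro h' ν' ⟨hν', hmag'⟩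
  obtain ⟨o', pa', hpa', hc'⟩ := TreeIsing.exists_hasChainLaw hG.connected hx hν' hmag'
  have hprob' := hν'.1.1
  -- The entry `x` depends on `q` and `β` but not on the field, so the measures agree before the
  -- fields are compared.
  obtain rfl := hc'.measure_unique hG hpa' hpa hx hc
  exact ⟨hν'.1.field_unique hG.connected hgibbs, rfl⟩
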